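/- Let $n\ge 1$ and let $G_c$ be a connected undirected simple graph on $\{1,\dots,n\}$, with degrees $d_1,\dots,d_n$, and let $p_1,\dots,p_n\in(0,1)$. In each time slot $k=1,2,\dots$ a random directed graph $\mathcal G_k$ is drawn: for every edge $\{u,v\}$ of $G_c$ the directed edge $(u,v)$ (from $u$ to $v$) is present in $\mathcal G_k$ with probability $p_v$, and the directed edge $(v,u)$ with probability $p_u$; all directed edges in all time slots are independent, and no other directed edge occurs. Let $\tilde A_k=[\tilde a^{(k)}_{uv}]$ be the adjacency matrix of $\mathcal G_k$, let $\tilde D_k$ be the diagonal matrix of the in-degrees $\tilde d^{(k)}_v=\sum_u\tilde a^{(k)}_{uv}$, and let $$W_k=(\tilde D_k+I)^{-1}(\tilde A_k+I)^T .$$ Let $\mathbf x(0)\in\mathbb R^n$ be a fixed vector of initial conditions, and let $\mathbf x(k)=W_k\,\mathbf x(k-1)$ for $k\ge 1$. Then, almost surely, all coordinates of $\mathbf x(k)$ converge, as $k\to\infty$, to one and the same number $x^*$, the asymptotic consensus value; $x^*$ is square integrable, and $$\operatorname{var}(x^*)\;\le\;\|\mathbf x(0)\otimes\mathbf x(0)\|_1\cdot\Big(\max_{1\le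 i\le n}S_i\Big)\cdot\frac{2(n^2-1)}{\prod_{(i,j)\ne(1,1)}(1-\lambda_i\lambda_j)} .$$ Here $\|\mathbf x(0)\otimes\mathbf x(0)\|_1=\sum_{1\le i,j\le n}|x_i(0)x_j(0)|$; for each $i$, $$S_i=2(1-M_i)\Big[M_i+\frac{M_i-1}{d_i}\Big],\qquad M_i=\mathbb E\Big[\frac1{B_i+1}\Big],\quad B_i\sim\mathrm{Binomial}(d_i,p_i),$$ (with $S_1=0$ if $n=1$); $\lambda_1,\dots,\lambda_n$ are the eigenvalues of the expected weight matrix $\mathbb E W_k$ (which does not depend on $k$), listed with algebraic multiplicity so that $|1-\lambda_1|\le\dots\le|1-\lambda_n|$; and the product, which runs over all pairs $(i,j)\in\{1,\dots,n\}^2$ other than $(1,1)$, is real and positive. -/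

import Mathlib

open MeasureTheory ProbabilityTheory Filter Topology

/-- A switching directed random graph process over the undirected graph `G` of potential
communication channels. In every time slot each directed edge `(u, v)` with `{u, v}` an edge of `G`
is present with probability `p v` (a probability attached to the receiving node `v`), independently
of all other directed edges (also of `(v, u)`) and of all other time slots; no other directed edge
ever occurs. The time slots are numbered from zero: `𝒢 k` is the graph in the `(k + 1)`-st slot. -/
structure IsSwitchingDigraphProcess {n : ℕ} {Ω : Type*} [MeasurableSpace Ω]
    (G : SimpleGraph (Fin n)) (p : Fin n → ℝ) (μ : Measure Ω)
    (𝒢 : ℕ → Ω → Digraph (Fin n)) : Prop where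
  adj_of_adj : ∀ k ω u v, (𝒢 k ω).Adj u v → G.Adj u v
  measurableSet_adj : ∀ k u v, MeasurableSet {ω | (𝒢 k ω).Adj u v}
  measure_adj : ∀ k u v, G.Adj u v → μ {ω | (𝒢 k ω).Adj u v} = ENNReal.ofReal (p v)
  indep_adj :
    iIndepSet (fun e : ℕ × Fin n × Fin n => {ω | (𝒢 e.1 ω).Adj e.2.1 e.2.2}) μ

open Classical in
/-- The adjacency matrix of a directed graph: the entry `(u, v)` is `1` if there is a directed edge
from `u` to `v`, and `0` otherwise. -/
noncomputable def digraphAdjMatrix {n : ℕ} (H : Digraph (Fin n)) : Matrix (Fin n) (Fin n) ℝ :=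
  Matrix.of fun u v => if H.Adj u v then 1 else 0

/-- The in-degree of the node `v`. -/
noncomputable def digraphInDegree {n : ℕ} (H : Digraph (Fin n)) (v : Fin n) : ℝ :=
  ∑ u, digraphAdjMatrix H u v

/-- The stochastic weight matrix `(D + I)⁻¹ (A + I)ᵀ` of a directed graph with adjacency matrix `A`
and diagonal matrix `D` of in-degrees. -/
noncomputable def weightMatrix {n : ℕ} (H : Digraph (Fin n)) : Matrix (Fin n) (Fin n) ℝ :=
  (Matrix.diagonal (digraphInDegree H) + 1)⁻¹ * (digraphAdjMatrix H + 1).transpose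

/-- The entrywise expectation `𝔼 W` of the weight matrix of a random directed graph. -/
noncomputable def expectedWeightMatrix {n : ℕ} {Ω : Type*} [MeasurableSpace Ω] (μ : Measure Ω)
    (𝒢 : Ω → Digraph (Fin n)) : Matrix (Fin n) (Fin n) ℝ :=
  Matrix.of fun i j => ∫ ω, weightMatrix (𝒢 ω) i j ∂μ

/-- The trajectory of `x (k + 1) = W x k` with initial condition `x₀`, where `W` is the weight
matrix of the graph in the `(k + 1)`-st time slot. -/
noncomputable def consensusState {n : ℕ} (H : ℕ → Digraph (Fin n)) (x₀ : Fin n → ℝ) :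
    ℕ → Fin n → ℝ
  | 0 => x₀
  | k + 1 => (weightMatrix (H k)).mulVec (consensusState H x₀ k)

/-- All coordinates of the trajectory `x` converge to the same number `c`. -/
def ReachesConsensusAt {n : ℕ} (x : ℕ → Fin n → ℝ) (c : ℝ) : Prop :=
  ∀ i, Tendsto (fun k => x k i) atTop (𝓝 c)

open Classical in
/-- The asymptotic consensus value of the trajectory `x` (and `0` if it reaches no consensus). -/
noncomputable def asymptoticConsensusValue {n : ℕ} (x : ℕ → Fin n → ℝ) : ℝ :=
  if h : ∃ c, ReachesConsensusAt x c then h.choose else 0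

/-- The Kronecker product `x ⊗ y` of two vectors. -/
def vecKronecker {n : ℕ} (x y : Fin n → ℝ) : Fin n × Fin n → ℝ := fun ij => x ij.1 * y ij.2

/-- `M = 𝔼[1 / (B + 1)]` for a binomial random variable `B` with `d` trials and success
probability `p`. -/
noncomputable def binomialInvMoment (d : ℕ) (p : ℝ) : ℝ :=
  ∑ k ∈ Finset.range (d + 1), (d.choose k : ℝ) * p ^ k * (1 - p) ^ (d - k) * (1 / ((k : ℝ) + 1))

/-- The node term `S = 2 (1 - M) [M + (M - 1) / d]` of a node with degree `d` and probability `p`.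
(On one vertex `d = 0` and `M = 1`, and the value is `0`.) -/
noncomputable def nodeTerm (d : ℕ) (p : ℝ) : ℝ :=
  2 * (1 - binomialInvMoment d p) *
    (binomialInvMoment d p + (binomialInvMoment d p - 1) / (d : ℝ))

/-- `lam` lists the complex eigenvalues of the real matrix `P`, with algebraic multiplicity, in the
order of their distance to `1`. -/
def IsEigenvalueListing {n : ℕ} (P : Matrix (Fin n) (Fin n) ℝ) (lam : Fin n → ℂ) : Prop :=
  (P.map (algebraMap ℝ ℂ)).charpoly.roots = Finset.univ.val.map lam ∧
    Monotone fun i => ‖1 - lam i‖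

/-! The dynamics is linear, so `x* = ∑ xⱼ(0) wⱼ`, where the random weight `wⱼ` is the consensus
value started from the `j`-th unit vector. Hence `var x*` is a sum of terms `xₐ(0) x_b(0) (m - π ⊗
π)(a, b)` with `m = 𝔼 [w ⊗ w]` and `π = 𝔼 w`, and it suffices to bound each covariance.

Slots are independent, so `m` is stationary for `S = 𝔼 [W ⊗ W]`, while `π ⊗ π` is stationary for `K
= 𝔼 W ⊗ 𝔼 W`. Thus `y = m - π ⊗ π` has sum zero and `y (1 - K) = m (S - K)`. The two matrices differ
only in the rows `(a, a)`, whose differences are covariances of the weights given by node `a`; their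
absolute sum is at most the node term (`sum_abs_subsetCovariance_averagingWeight_le`).

It remains to invert `1 - K` on vectors of sum zero. The principal minors of `1 - K` are positive
stationary weights, and all its cofactors in question have absolute value at most one, which gives
`|y j| * ∑ weights ≤ (n² - 1) * ‖m (S - K)‖₁` (`abs_apply_mul_sum_stationaryWeight_le`). The sum of
these minors is the product of the remaining eigenvalues `1 - λᵢ λⱼ` of `1 - K`
(`sum_stationaryWeight_kronecker_self`), hence the denominator.

Almost sure consensus comes from the Lyapunov function `∑ wᵢ 𝔼 xᵢ²` with `w` stationary for `𝔼 W`: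
its decrements control the mean squared differences along the edges, which are therefore summable.
-/

namespace Matrix

/-! ### Determinants of Kronecker squares. -/

open Polynomial in
/-- If `lam` lists the roots of the characteristic polynomial of `P`, then
`det (x - y P) = ∏ (x - y λᵢ)`. -/
theorem det_smul_one_sub_smul_of_charpoly {ι : Type*} [Fintype ι] [DecidableEq ι]
    {P : Matrix ι ι ℂ} {lam : ι → ℂ} (h : P.charpoly = ∏ i, (X - C (lam i))) (x y : ℂ) :
    (x • (1 : Matrix ι ι ℂ) - y • P).det = ∏ i, (x - y * lam i) := by
  rcases eq_or_ne y 0 with rfl | hy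
  · simp
  · have h1 : x • (1 : Matrix ι ι ℂ) - y • P = y • (scalar ι (x / y) - P) := by
      rw [smul_sub]
      congr 1
      ext i j
      simp only [Matrix.smul_apply, Matrix.scalar_apply, Matrix.one_apply, Matrix.diagonal_apply]
      split_ifs
      · simp; field_simp
      · simp
    rw [h1, Matrix.det_smul, ← Matrix.eval_charpoly, h, Polynomial.eval_prod, Fintype.card,
      ← Finset.prod_const, ← Finset.prod_mul_distrib]
    refine Finset.prod_congr rfl fun i _ => ?_
    simp
    field_simp

-- The blocks of `x - P ⊗ P` are polynomials in `P` and commute, so by `Matrix.det_det` the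
-- determinant may be taken first over `ℂ[X]` and then, after substituting `P` for `X`, over `ℂ`. No
-- diagonalization is needed.
open Polynomial Kronecker in
theorem det_smul_one_sub_kronecker_self {ι : Type*} [Fintype ι] [DecidableEq ι]
    {P : Matrix ι ι ℂ} {lam : ι → ℂ} (h : P.charpoly = ∏ i, (X - C (lam i))) (x : ℂ) :
    (x • (1 : Matrix (ι × ι) (ι × ι) ℂ) - P ⊗ₖ P).det =
      ∏ ij : ι × ι, (x - lam ij.1 * lam ij.2) := by
  let f : ℂ[X] →+* Matrix ι ι ℂ := (aeval P : ℂ[X] →ₐ[ℂ] Matrix ι ι ℂ)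
  let M : Matrix ι ι ℂ[X] := C x • (1 : Matrix ι ι ℂ[X]) - (X : ℂ[X]) • P.map C
  have hM : M.det = ∏ i, (C x - X * C (lam i)) := by
    refine Polynomial.funext fun y => ?_
    rw [← Polynomial.coe_evalRingHom, RingHom.map_det, RingHom.mapMatrix_apply]
    have : M.map (evalRingHom y) = x • (1 : Matrix ι ι ℂ) - y • P := by
      ext i j
      simp [M, Matrix.one_apply]
      split_ifs <;> simp [mul_comm]
    rw [this, det_smul_one_sub_smul_of_charpoly h]
    simp only [coe_evalRingHom, eval_prod, eval_sub, eval_C, eval_mul, eval_X]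
  have hdet := Matrix.det_det M f
  have hC : ∀ a, f (C a) = a • 1 := fun a => by
    simp only [f, RingHom.coe_coe, Polynomial.aeval_C, Algebra.algebraMap_eq_smul_one]
  have hX : f X = P := by simp only [f, RingHom.coe_coe, Polynomial.aeval_X]
  have hcomp : (M.map f).comp ι ι ι ι ℂ = x • (1 : Matrix (ι × ι) (ι × ι) ℂ) - P ⊗ₖ P := by
    ext ⟨i, k⟩ ⟨j, l⟩
    have hij : (M.map f) i j = f (C x * (1 : Matrix ι ι ℂ[X]) i j - X * C (P i j)) := rfl
    rw [Matrix.comp_apply, hij, map_sub, map_mul, map_mul, hC, hX, hC, Matrix.sub_apply,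
      Matrix.sub_apply, Matrix.smul_apply, Matrix.kroneckerMap_apply, Matrix.one_apply,
      Matrix.one_apply, smul_one_mul, mul_smul_one, Matrix.smul_apply, Matrix.smul_apply]
    by_cases h1 : i = j <;> by_cases h2 : k = l <;> simp [h1, h2]
  let g : ℂ[X] →* ℂ := Matrix.detMonoidHom.comp (f : ℂ[X] →* Matrix ι ι ℂ)
  have hg : ∀ q, (f q).det = g q := fun q => rfl
  rw [← hcomp, ← hdet, hM, hg, map_prod, Fintype.prod_prod_type]
  refine Finset.prod_congr rfl fun i _ => ?_
  rw [← hg, map_sub, map_mul, hC, hX, hC, mul_smul_one, det_smul_one_sub_smul_of_charpoly h]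

/-! ### Minors of `1 - B` for substochastic `B`. -/

/-- A matrix with nonnegative entries and row sums at most one. -/
structure IsSubstochastic {ι : Type*} [Fintype ι] (B : Matrix ι ι ℝ) : Prop where
  nonneg : ∀ i j, 0 ≤ B i j
  row_sum_le : ∀ i, ∑ j, B i j ≤ 1

/-- A matrix with nonnegative entries and row sums one. -/
structure IsStochastic {ι : Type*} [Fintype ι] (B : Matrix ι ι ℝ) : Prop where
  nonneg : ∀ i j, 0 ≤ B i j
  row_sum : ∀ i, ∑ j, B i j = 1

section Substochastic

variable {ι : Type*} [Fintype ι] [DecidableEq ι] {B : Matrix ι ι ℝ}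

omit [DecidableEq ι] in
theorem IsStochastic.isSubstochastic (h : B.IsStochastic) : B.IsSubstochastic :=
  ⟨h.nonneg, fun i => (h.row_sum i).le⟩

theorem IsSubstochastic.updateRow (h : B.IsSubstochastic) (s : ι) {b : ι → ℝ}
    (hb : ∀ j, 0 ≤ b j) (hb1 : ∑ j, b j ≤ 1) : (B.updateRow s b).IsSubstochastic := by
  constructor
  · intro i j
    rcases eq_or_ne i s with rfl | hi
    · simpa using hb j
    · simpa [hi] using h.nonneg i j
  · intro i
    rcases eq_or_ne i s with rfl | hi
    · simpa using hb1
    · simpa [hi] using h.row_sum_le i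

theorem det_one_sub_ne_zero_of_row_sum_lt (h0 : ∀ i j, 0 ≤ B i j) (h1 : ∀ i, ∑ j, B i j < 1) :
    (1 - B).det ≠ 0 := by
  refine det_ne_zero_of_sum_row_lt_diag fun k => ?_
  have hk := h1 k
  have hk0 := h0 k k
  rw [← Finset.add_sum_erase _ _ (Finset.mem_univ k)] at hk
  have hsum : ∑ j ∈ Finset.univ.erase k, ‖(1 - B) k j‖ = ∑ j ∈ Finset.univ.erase k, B k j := by
    refine Finset.sum_congr rfl fun j hj => ?_
    have hjk : k ≠ j := (Finset.ne_of_mem_erase hj).symm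
    simp [hjk, abs_of_nonneg (h0 k j)]
  rw [hsum]
  have hn : 0 ≤ ∑ j ∈ Finset.univ.erase k, B k j := Finset.sum_nonneg fun j _ => h0 k j
  refine lt_of_lt_of_le ?_ (le_abs_self _)
  rw [Matrix.sub_apply, Matrix.one_apply_eq]
  linarith

/-- Along `t • B`, `0 ≤ t ≤ 1`, the determinant starts at one and never vanishes. -/
theorem det_one_sub_pos_of_row_sum_lt (h0 : ∀ i j, 0 ≤ B i j) (h1 : ∀ i, ∑ j, B i j < 1) :
    0 < (1 - B).det := by
  by_contra hneg
  have hcont : Continuous fun t : ℝ => (1 - t • B).det := by fun_prop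
  have : (0 : ℝ) ∈ (fun t : ℝ => (1 - t • B).det) '' Set.Icc 0 1 := by
    refine intermediate_value_Icc' zero_le_one hcont.continuousOn ⟨?_, ?_⟩
    · simpa using hneg
    · simp
  obtain ⟨t, ht, hdet⟩ := this
  refine det_one_sub_ne_zero_of_row_sum_lt (B := t • B) ?_ ?_ hdet
  · intro i j
    exact mul_nonneg ht.1 (h0 i j)
  · intro i
    simp only [Matrix.smul_apply, smul_eq_mul, ← Finset.mul_sum]
    have := Finset.sum_nonneg fun j (_ : j ∈ Finset.univ) => h0 i j
    nlinarith [h1 i, ht.1, ht.2]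

/-- The minimum principle for `1 - B`. -/
theorem nonneg_of_one_sub_mulVec_nonneg (h0 : ∀ i j, 0 ≤ B i j) (h1 : ∀ i, ∑ j, B i j < 1)
    {x : ι → ℝ} (hx : ∀ i, 0 ≤ ((1 - B) *ᵥ x) i) (i : ι) : 0 ≤ x i := by
  have : Nonempty ι := ⟨i⟩
  obtain ⟨s, hs⟩ := Finite.exists_min x
  refine le_trans ?_ (hs i)
  by_contra hneg
  push Not at hneg
  have h2 := hx s
  rw [Matrix.sub_mulVec, Matrix.one_mulVec, Pi.sub_apply] at h2
  have h3 : (∑ j, B s j) * x s ≤ (B *ᵥ x) s := by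
    rw [Finset.sum_mul]
    exact Finset.sum_le_sum fun j _ => mul_le_mul_of_nonneg_left (hs j) (h0 s j)
  nlinarith [h1 s]

/-- The minimum principle applies to the columns of the adjugate, since `1 - B` maps them to
nonnegative multiples of unit vectors. -/
theorem adjugate_one_sub_nonneg_of_row_sum_lt (h0 : ∀ i j, 0 ≤ B i j)
    (h1 : ∀ i, ∑ j, B i j < 1) (i j : ι) : 0 ≤ (1 - B).adjugate i j := by
  refine nonneg_of_one_sub_mulVec_nonneg h0 h1 (x := fun i => (1 - B).adjugate i j) ?_ i
  intro k
  have : ((1 - B) *ᵥ fun i => (1 - B).adjugate i j) k = ((1 - B) * (1 - B).adjugate) k j := rfl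
  rw [this, Matrix.mul_adjugate, Matrix.smul_apply, Matrix.one_apply]
  have := (det_one_sub_pos_of_row_sum_lt h0 h1).le
  split_ifs <;> simp [this]

theorem det_updateRow_eq_sum_adjugate {R : Type*} [CommRing R] (C : Matrix ι ι R) (s : ι)
    (b : ι → R) : (C.updateRow s b).det = ∑ r, b r * C.adjugate r s := by
  rw [← Matrix.cramer_transpose_apply, Matrix.cramer_eq_adjugate_mulVec,
    ← Matrix.adjugate_transpose]
  simp only [Matrix.mulVec, dotProduct, Matrix.transpose_apply, mul_comm]

theorem det_updateRow_sub {R : Type*} [CommRing R] (C : Matrix ι ι R) (s : ι) (a b : ι → R) :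
    (C.updateRow s (a - b)).det = (C.updateRow s a).det - (C.updateRow s b).det := by
  simp only [det_updateRow_eq_sum_adjugate, Pi.sub_apply, sub_mul, Finset.sum_sub_distrib]

/-- The rows of `B` are switched on one at a time, starting from the identity matrix; each new row
lowers the determinant by a nonnegative combination of cofactors. -/
theorem det_one_sub_le_one_of_row_sum_lt (h0 : ∀ i j, 0 ≤ B i j)
    (h1 : ∀ i, ∑ j, B i j < 1) : (1 - B).det ≤ 1 := by
  have key : ∀ S : Finset ι,
      (1 - Matrix.of fun i j => if i ∈ S then B i j else 0 : Matrix ι ι ℝ).det ≤ 1 := by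
    intro S
    induction S using Finset.induction_on with
    | empty =>
      have : (Matrix.of fun i j => if i ∈ (∅ : Finset ι) then B i j else 0) = 0 := by
        ext; simp
      rw [this]
      simp
    | insert s S hs ih =>
      set D : Matrix ι ι ℝ := Matrix.of fun i j => if i ∈ S then B i j else 0 with hD
      have hD0 : ∀ i j, 0 ≤ D i j := by
        intro i j
        simp only [hD, Matrix.of_apply]
        split_ifs
        exacts [h0 i j, le_rfl]
      have hD1 : ∀ i, ∑ j, D i j < 1 := by
        intro i
        by_cases hi : i ∈ S
        · simpa [hD, hi] using h1 i
        · simp [hD, hi]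
      -- Row `s` of `D` is still zero, so the new row is the old one minus `B s`.
      have heq : (1 - Matrix.of fun i j => if i ∈ insert s S then B i j else 0 : Matrix ι ι ℝ) =
          (1 - D).updateRow s ((1 - D) s - B s) := by
        ext i j
        rcases eq_or_ne i s with rfl | hi
        · simp [hD, hs]
        · simp [hD, hi]
      rw [heq, Matrix.det_updateRow_sub, Matrix.updateRow_eq_self, det_updateRow_eq_sum_adjugate]
      have : 0 ≤ ∑ r, B s r * (1 - D).adjugate r s := Finset.sum_nonneg fun r _ =>
        mul_nonneg (h0 s r) (adjugate_one_sub_nonneg_of_row_sum_lt hD0 hD1 r s)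
      linarith
  have hB : (Matrix.of fun i j => if i ∈ Finset.univ then B i j else 0) = B := by
    ext; simp
  simpa only [hB] using key Finset.univ

theorem IsSubstochastic.det_one_sub_mem_Icc (h : B.IsSubstochastic) :
    (1 - B).det ∈ Set.Icc (0 : ℝ) 1 := by
  have hcont : Continuous fun t : ℝ => (1 - t • B).det := by fun_prop
  have hlim : Tendsto (fun t : ℝ => (1 - t • B).det) (𝓝[<] 1) (𝓝 (1 - B).det) := by
    have := hcont.tendsto 1
    simp only [one_smul] at this
    exact this.mono_left nhdsWithin_le_nhds
  refine isClosed_Icc.mem_of_tendsto hlim ?_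
  have h01 : ∀ᶠ t : ℝ in 𝓝[<] 1, t ∈ Set.Ioo (0 : ℝ) 1 := Ioo_mem_nhdsLT zero_lt_one
  filter_upwards [h01] with t ht
  have a0 : ∀ i j, 0 ≤ (t • B) i j := fun i j => mul_nonneg ht.1.le (h.nonneg i j)
  have a1 : ∀ i, ∑ j, (t • B) i j < 1 := by
    intro i
    simp only [Matrix.smul_apply, smul_eq_mul, ← Finset.mul_sum]
    have := Finset.sum_nonneg fun j (_ : j ∈ Finset.univ) => h.nonneg i j
    nlinarith [h.row_sum_le i, ht.1, ht.2]
  exact ⟨(det_one_sub_pos_of_row_sum_lt a0 a1).le, det_one_sub_le_one_of_row_sum_lt a0 a1⟩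

/-- Replacing row `s` of `B` by zero or by the unit vector at `r` keeps it substochastic. The two
determinants lie in `[0, 1]`, and the cofactor is their difference. -/
theorem IsSubstochastic.abs_adjugate_one_sub_le (h : B.IsSubstochastic) (r s : ι) :
    |(1 - B).adjugate r s| ≤ 1 := by
  have h1 : ∀ b : ι → ℝ, (1 - B).updateRow s (Pi.single s 1 - b) = 1 - B.updateRow s b := by
    intro b
    ext i j
    rcases eq_or_ne i s with rfl | hi
    · simp [Matrix.one_apply, Pi.single_apply, eq_comm]
    · simp [hi]
  have e0 := (h.updateRow s (b := 0) (by simp) (by simp)).det_one_sub_mem_Icc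
  have e1 := (h.updateRow s (b := Pi.single r 1)
    (fun j => by rw [Pi.single_apply]; split_ifs <;> simp) (by simp)).det_one_sub_mem_Icc
  rw [← h1] at e0 e1
  rw [Matrix.det_updateRow_sub, Matrix.adjugate_apply .. |>.symm,
    Matrix.adjugate_apply .. |>.symm] at e1
  rw [sub_zero, Matrix.adjugate_apply .. |>.symm] at e0
  have := e0.1; have := e0.2; have := e1.1; have := e1.2
  rw [abs_le]
  constructor <;> linarith

end Substochastic

end Matrix

/-! ### Stationary weights of irreducible chains and their sensitivity. -/

namespace Matrix

section Irreducible

variable {ι : Type*} [Fintype ι] [DecidableEq ι] {P : Matrix ι ι ℝ}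

/-- The stationary weights `det (1 - P)` with the row `j` replaced by a unit vector. -/
noncomputable def stationaryWeight (P : Matrix ι ι ℝ) (j : ι) : ℝ := (1 - P).adjugate j j

omit [Fintype ι] in
theorem one_sub_updateRow (P : Matrix ι ι ℝ) (j : ι) :
    (1 - P).updateRow j (Pi.single j 1) = 1 - P.updateRow j 0 := by
  ext i k
  rcases eq_or_ne i j with rfl | hi
  · simp [Matrix.one_apply, Pi.single_apply, eq_comm]
  · simp [hi]

theorem stationaryWeight_eq_det (P : Matrix ι ι ℝ) (j : ι) :
    stationaryWeight P j = (1 - P.updateRow j 0).det := by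
  rw [stationaryWeight, Matrix.adjugate_apply, one_sub_updateRow]

theorem IsStochastic.updateRow_zero (hP : P.IsStochastic) (j : ι) :
    (P.updateRow j 0).IsSubstochastic :=
  hP.isSubstochastic.updateRow j (by simp) (by simp)

omit [DecidableEq ι] in
/-- The maximum principle for harmonic functions that vanish at `j`. -/
theorem IsStochastic.eq_zero_of_harmonic (hP : P.IsStochastic) {j : ι}
    (hirr : ∀ i, Relation.ReflTransGen (fun a b => 0 < P a b) i j) {x : ι → ℝ} (hj : x j = 0)
    (hx : ∀ s, s ≠ j → x s = ∑ r, P s r * x r) : x = 0 := by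
  have : Nonempty ι := ⟨j⟩
  obtain ⟨s, hs⟩ := Finite.exists_max fun i => |x i|
  -- A maximum of `|x|` spreads along positive transitions until the path meets `j`, where `x`
  -- vanishes.
  have hprop : ∀ i k, Relation.ReflTransGen (fun a b => 0 < P a b) i k → |x i| = |x s| →
      |x s| = 0 ∨ |x k| = |x s| := by
    intro i k hik hi
    induction hik with
    | refl => exact Or.inr hi
    | @tail b c _ hbc ih =>
      rcases ih with h0 | hb
      · exact Or.inl h0
      by_cases hbj : b = j
      · left
        rw [← hb, hbj, hj, abs_zero]
      right
      refine le_antisymm (hs c) ?_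
      by_contra hlt
      push Not at hlt
      have h1 : |x b| ≤ ∑ r, P b r * |x r| := by
        rw [hx b hbj]
        refine (Finset.abs_sum_le_sum_abs _ _).trans_eq ?_
        exact Finset.sum_congr rfl fun r _ => by rw [abs_mul, abs_of_nonneg (hP.nonneg b r)]
      have h2 : ∑ r, P b r * |x r| < ∑ r, P b r * |x s| :=
        Finset.sum_lt_sum (fun r _ => mul_le_mul_of_nonneg_left (hs r) (hP.nonneg b r))
          ⟨c, Finset.mem_univ c, mul_lt_mul_of_pos_left hlt hbc⟩
      rw [← Finset.sum_mul, hP.row_sum, one_mul] at h2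
      linarith
  have hzero : |x s| = 0 := by
    rcases hprop s j (hirr s) rfl with h | h
    · exact h
    · rw [← h, hj, abs_zero]
  ext i
  exact abs_nonpos_iff.mp (hzero ▸ hs i)

/-- A kernel vector of the matrix with row `j` of `P` erased vanishes at `j` and is harmonic
elsewhere, hence is zero. -/
theorem IsStochastic.stationaryWeight_pos (hP : P.IsStochastic) {j : ι}
    (hirr : ∀ i, Relation.ReflTransGen (fun a b => 0 < P a b) i j) :
    0 < stationaryWeight P j := by
  rw [stationaryWeight_eq_det]
  refine lt_of_le_of_ne (hP.updateRow_zero j).det_one_sub_mem_Icc.1 fun h => ?_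
  obtain ⟨x, hx0, hx⟩ := Matrix.exists_mulVec_eq_zero_iff.mpr h.symm
  refine hx0 (hP.eq_zero_of_harmonic hirr ?_ ?_)
  · have := congrFun hx j
    rw [Matrix.sub_mulVec, Matrix.one_mulVec] at this
    simpa [Matrix.mulVec, dotProduct] using this
  · intro s hs
    have := congrFun hx s
    rw [Matrix.sub_mulVec, Matrix.one_mulVec] at this
    simpa [Matrix.mulVec, dotProduct, hs, sub_eq_zero] using this

theorem IsStochastic.one_sub_mulVec_one (hP : P.IsStochastic) : (1 - P) *ᵥ 1 = 0 := by
  ext i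
  rw [Matrix.sub_mulVec, Matrix.one_mulVec]
  simp [Matrix.mulVec, dotProduct, hP.row_sum]

theorem IsStochastic.det_one_sub [Nonempty ι] (hP : P.IsStochastic) : (1 - P).det = 0 :=
  Matrix.exists_mulVec_eq_zero_iff.mp ⟨1, one_ne_zero, hP.one_sub_mulVec_one⟩

/-- As `1 - P` is singular, it annihilates the columns of its adjugate. They are thus harmonic, and
the maximum principle makes them constant. -/
theorem IsStochastic.adjugate_one_sub_apply (hP : P.IsStochastic)
    (hirr : ∀ i j, Relation.ReflTransGen (fun a b => 0 < P a b) i j) (i j : ι) :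
    (1 - P).adjugate i j = stationaryWeight P j := by
  have : Nonempty ι := ⟨i⟩
  have hcol : ∀ s, (1 - P).adjugate s j = ∑ r, P s r * (1 - P).adjugate r j := by
    intro s
    have h : ((1 - P) * (1 - P).adjugate) s j = 0 := by
      rw [Matrix.mul_adjugate, hP.det_one_sub]; simp
    rw [Matrix.sub_mul, Matrix.one_mul, Matrix.sub_apply, Matrix.mul_apply, sub_eq_zero] at h
    exact h
  have h0 := hP.eq_zero_of_harmonic (j := j) (fun i => hirr i j)
    (x := fun s => (1 - P).adjugate s j - (1 - P).adjugate j j) (sub_self _) (fun s _ => by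
      simp only [mul_sub, Finset.sum_sub_distrib, ← Finset.sum_mul, hP.row_sum, one_mul, ← hcol])
  exact sub_eq_zero.mp (congrFun h0 i)

theorem IsStochastic.stationaryWeight_vecMul [Nonempty ι] (hP : P.IsStochastic)
    (hirr : ∀ i j, Relation.ReflTransGen (fun a b => 0 < P a b) i j) (c : ι) :
    ∑ r, stationaryWeight P r * P r c = stationaryWeight P c := by
  obtain ⟨i⟩ := ‹Nonempty ι›
  have : Nonempty ι := ⟨i⟩
  have h : ((1 - P).adjugate * (1 - P)) i c = 0 := by
    rw [Matrix.adjugate_mul, hP.det_one_sub]; simp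
  rw [Matrix.mul_sub, Matrix.mul_one, Matrix.sub_apply, Matrix.mul_apply, sub_eq_zero] at h
  simpa [hP.adjugate_one_sub_apply hirr] using h.symm

/-- The sensitivity bound for the stationary distribution of an irreducible Markov chain: a vector
`y` with vanishing sum is bounded in terms of `y (1 - P)`. -/
theorem IsStochastic.abs_apply_mul_sum_stationaryWeight_le [Nonempty ι] (hP : P.IsStochastic)
    (hirr : ∀ i j, Relation.ReflTransGen (fun a b => 0 < P a b) i j) {y q : ι → ℝ}
    (hy : ∑ i, y i = 0) (hyq : ∀ c, y c - ∑ r, y r * P r c = q c) (j : ι) :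
    |y j| * ∑ i, stationaryWeight P i ≤ (Fintype.card ι - 1) * ∑ i, |q i| := by
  set w := stationaryWeight P with hw
  set C : Matrix ι ι ℝ := 1 - P.updateRow j 0 with hC
  have hdet : C.det = w j := (stationaryWeight_eq_det P j).symm
  have hwj : 0 < w j := hP.stationaryWeight_pos fun i => hirr i j
  -- Subtracting a multiple of the stationary vector makes coordinate `j` vanish without changing
  -- the image under `1 - P`, up to the factor `w j`. Row `j` of `P` then plays no role, and the
  -- singular `1 - P` may be replaced by the invertible `C`.
  let z : ι → ℝ := fun i => w j * y i - y j * w i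
  have hzj : z j = 0 := by simp only [z]; ring
  have hzC : z ᵥ* C = w j • q := by
    ext c
    have h1 : ∑ r, z r * P.updateRow j 0 r c = ∑ r, z r * P r c := by
      refine Finset.sum_congr rfl fun r _ => ?_
      rcases eq_or_ne r j with rfl | hr
      · simp [hzj]
      · simp [hr]
    rw [hC, Matrix.vecMul_sub, Matrix.vecMul_one]
    simp only [Pi.sub_apply, Matrix.vecMul, dotProduct, Pi.smul_apply, smul_eq_mul]
    rw [h1, ← hyq c]
    simp only [z, sub_mul, Finset.sum_sub_distrib, mul_assoc, ← Finset.mul_sum]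
    rw [hP.stationaryWeight_vecMul hirr]
    ring
  have hz : z = q ᵥ* C.adjugate := by
    have h1 : (z ᵥ* C) ᵥ* C.adjugate = w j • z := by
      rw [Matrix.vecMul_vecMul, Matrix.mul_adjugate, hdet]
      simp [Matrix.vecMul_smul]
    rw [hzC, Matrix.smul_vecMul] at h1
    exact (smul_right_injective _ hwj.ne' h1).symm
  -- Since `y` has sum zero, the sum of `z` recovers `y j` times the total weight.
  have hzsum : ∑ i, z i = -(y j * ∑ i, w i) := by
    simp only [z, Finset.sum_sub_distrib, ← Finset.mul_sum, hy]
    ring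
  have hwsum : 0 ≤ ∑ i, w i := Finset.sum_nonneg fun i _ =>
    (hP.stationaryWeight_pos fun k => hirr k i).le
  have hzle : ∀ i, |z i| ≤ ∑ r, |q r| := by
    intro i
    rw [hz]
    refine (Finset.abs_sum_le_sum_abs _ _).trans (Finset.sum_le_sum fun r _ => ?_)
    rw [abs_mul]
    exact mul_le_of_le_one_right (abs_nonneg _)
      ((hP.updateRow_zero j).abs_adjugate_one_sub_le r i)
  calc |y j| * ∑ i, w i = |∑ i, z i| := by rw [hzsum, abs_neg, abs_mul, abs_of_nonneg hwsum]
    -- Dropping the zero term at `j` yields `card - 1` instead of `card`.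
    _ = |∑ i ∈ Finset.univ.erase j, z i| := by rw [Finset.sum_erase _ hzj]
    _ ≤ ∑ i ∈ Finset.univ.erase j, |z i| := Finset.abs_sum_le_sum_abs _ _
    _ ≤ ∑ i ∈ Finset.univ.erase j, ∑ r, |q r| := Finset.sum_le_sum fun i _ => hzle i
    _ = (Fintype.card ι - 1) * ∑ i, |q i| := by
      rw [Finset.sum_const, Finset.card_erase_of_mem (Finset.mem_univ j), nsmul_eq_mul,
        Finset.card_univ, Nat.cast_sub Fintype.card_pos, Nat.cast_one]

end Irreducible

open Kronecker Polynomial in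
/-- The sum of the stationary weights of `P ⊗ P` as a product over the eigenvalues of `P`. -/
theorem sum_stationaryWeight_kronecker_self {ι : Type*} [Fintype ι] [DecidableEq ι]
    {P : Matrix ι ι ℝ} (hP : (P ⊗ₖ P).IsStochastic)
    (hirr : ∀ i j, Relation.ReflTransGen (fun a b => 0 < (P ⊗ₖ P) a b) i j)
    {lam : ι → ℂ} (h : (P.map (algebraMap ℝ ℂ)).charpoly = ∏ i, (X - C (lam i))) {o : ι}
    (ho : lam o = 1) :
    ((∑ ij, stationaryWeight (P ⊗ₖ P) ij : ℝ) : ℂ) =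
      ∏ ij ∈ Finset.univ.erase (o, o), (1 - lam ij.1 * lam ij.2) := by
  set K := P ⊗ₖ P with hK
  -- Both `a t` and `b t` equal `det ((1 + t) - K) / t` for `t ≠ 0`: `a` because the row sums of
  -- this matrix are `t`, `b` because the factor at `(o, o)` is `t`. Both are continuous, so they
  -- agree at `t = 0`.
  let a : ℝ → ℝ := fun t => (((1 + t) • (1 : Matrix (ι × ι) (ι × ι) ℝ) - K).adjugate *ᵥ 1) (o, o)
  let b : ℝ → ℂ := fun t => ∏ ij ∈ Finset.univ.erase (o, o), (1 + t - lam ij.1 * lam ij.2)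
  have hab : ∀ t : ℝ, t ≠ 0 → (a t : ℂ) = b t := by
    intro t ht
    set M : Matrix (ι × ι) (ι × ι) ℝ := (1 + t) • 1 - K with hM
    have hM1 : M *ᵥ 1 = t • 1 := by
      have h1 : M = t • 1 + (1 - K) := by rw [hM, add_smul, one_smul]; abel
      rw [h1, Matrix.add_mulVec, hP.one_sub_mulVec_one, Matrix.smul_mulVec, Matrix.one_mulVec,
        add_zero]
    have hdet : M.det = t * a t := by
      have h1 : M.adjugate *ᵥ (M *ᵥ 1) = M.det • 1 := by
        rw [Matrix.mulVec_mulVec, Matrix.adjugate_mul, Matrix.smul_mulVec, Matrix.one_mulVec]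
      rw [hM1, Matrix.mulVec_smul] at h1
      have h2 := congrFun h1 (o, o)
      simpa using h2.symm
    have hdetC : (M.det : ℂ) = t * b t := by
      have h1 : (M.det : ℂ) = (M.map (algebraMap ℝ ℂ)).det :=
        RingHom.map_det (algebraMap ℝ ℂ) M
      have h2 : M.map (algebraMap ℝ ℂ) = ((1 + t : ℝ) : ℂ) • (1 : Matrix (ι × ι) (ι × ι) ℂ) -
          P.map (algebraMap ℝ ℂ) ⊗ₖ P.map (algebraMap ℝ ℂ) := by
        ext i j
        simp only [hM, hK, Matrix.map_apply, Matrix.sub_apply, Matrix.smul_apply,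
          Matrix.kroneckerMap_apply, Matrix.one_apply]
        split_ifs <;> simp
      rw [h1, h2, det_smul_one_sub_kronecker_self h,
        ← Finset.mul_prod_erase _ _ (Finset.mem_univ (o, o))]
      simp [ho, b]
    rw [hdet, Complex.ofReal_mul] at hdetC
    exact mul_left_cancel₀ (by exact_mod_cast ht) hdetC
  have ha : Continuous fun t => (a t : ℂ) := by
    refine Complex.continuous_ofReal.comp ?_
    have : Continuous fun t : ℝ =>
      ((1 + t) • (1 : Matrix (ι × ι) (ι × ι) ℝ) - K).adjugate *ᵥ (1 : ι × ι → ℝ) :=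
      Continuous.matrix_mulVec (Continuous.matrix_adjugate (by fun_prop)) continuous_const
    exact (continuous_apply (o, o)).comp this
  have hb : Continuous b := by
    refine continuous_finsetProd _ fun ij _ => ?_
    fun_prop
  have hab0 : (a 0 : ℂ) = b 0 := by
    have h1 : Tendsto (fun t => (a t : ℂ)) (𝓝[≠] 0) (𝓝 (a 0 : ℂ)) :=
      (ha.tendsto 0).mono_left nhdsWithin_le_nhds
    have h2 : Tendsto b (𝓝[≠] 0) (𝓝 (b 0)) := (hb.tendsto 0).mono_left nhdsWithin_le_nhds
    refine tendsto_nhds_unique (h1.congr' ?_) h2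
    filter_upwards [self_mem_nhdsWithin] with t ht using hab t ht
  have ha0 : a 0 = ∑ ij, stationaryWeight K ij := by
    simp only [a, add_zero, one_smul, Matrix.mulVec, dotProduct, Pi.one_apply, mul_one]
    exact Finset.sum_congr rfl fun j _ => hP.adjugate_one_sub_apply hirr _ _
  rw [← ha0, hab0]
  simp [b]

end Matrix

/-! ### Random sets of in-neighbours and the covariances of averaging weights. -/

section RandomSubset

variable {α : Type*} [DecidableEq α]

/-- The expectation of `f S` for the random subset `S` of `N` that contains each element
independently with probability `p`. -/
noncomputable def subsetExpectation (p : ℝ) (N : Finset α) (f : Finset α → ℝ) : ℝ :=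
  ∑ s ∈ N.powerset, p ^ s.card * (1 - p) ^ (N.card - s.card) * f s

/-- The covariance of `f S` and `g S` for the random subset `S` of `N` that contains each element
independently with probability `p`. -/
noncomputable def subsetCovariance (p : ℝ) (N : Finset α) (f g : Finset α → ℝ) : ℝ :=
  subsetExpectation p N (fun s => f s * g s) - subsetExpectation p N f * subsetExpectation p N g

/-- The weight that the node `i` with the set `s` of in-neighbours gives to the node `j`. -/
noncomputable def averagingWeight (i : α) (j : α) (s : Finset α) : ℝ :=
  if j ∈ insert i s then 1 / ((s.card : ℝ) + 1) else 0

variable {p : ℝ} {N : Finset α}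

omit [DecidableEq α] in
theorem subsetExpectation_congr {f g : Finset α → ℝ} (h : ∀ s ⊆ N, f s = g s) :
    subsetExpectation p N f = subsetExpectation p N g :=
  Finset.sum_congr rfl fun s hs => by rw [h s (Finset.mem_powerset.mp hs)]

omit [DecidableEq α] in
theorem subsetExpectation_const (c : ℝ) : subsetExpectation p N (fun _ => c) = c := by
  rw [subsetExpectation, ← Finset.sum_mul, Finset.sum_pow_mul_eq_add_pow]
  simp

omit [DecidableEq α] in
theorem subsetExpectation_add (f g : Finset α → ℝ) :
    subsetExpectation p N (fun s => f s + g s) =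
      subsetExpectation p N f + subsetExpectation p N g := by
  simp only [subsetExpectation, mul_add, Finset.sum_add_distrib]

omit [DecidableEq α] in
theorem subsetExpectation_sub (f g : Finset α → ℝ) :
    subsetExpectation p N (fun s => f s - g s) =
      subsetExpectation p N f - subsetExpectation p N g := by
  simp only [subsetExpectation, mul_sub, Finset.sum_sub_distrib]

omit [DecidableEq α] in
theorem subsetExpectation_const_mul (c : ℝ) (f : Finset α → ℝ) :
    subsetExpectation p N (fun s => c * f s) = c * subsetExpectation p N f := by
  rw [subsetExpectation, subsetExpectation, Finset.mul_sum]
  exact Finset.sum_congr rfl fun s _ => by ring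

omit [DecidableEq α] in
theorem subsetExpectation_sum {β : Type*} (t : Finset β) (f : β → Finset α → ℝ) :
    subsetExpectation p N (fun s => ∑ b ∈ t, f b s) = ∑ b ∈ t, subsetExpectation p N (f b) := by
  simp only [subsetExpectation, Finset.mul_sum]
  exact Finset.sum_comm

omit [DecidableEq α] in
theorem subsetExpectation_mono (hp : p ∈ Set.Icc (0 : ℝ) 1) {f g : Finset α → ℝ}
    (h : ∀ s ⊆ N, f s ≤ g s) : subsetExpectation p N f ≤ subsetExpectation p N g :=
  Finset.sum_le_sum fun s hs => mul_le_mul_of_nonneg_left (h s (Finset.mem_powerset.mp hs))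
    (mul_nonneg (pow_nonneg hp.1 _) (pow_nonneg (sub_nonneg.mpr hp.2) _))

omit [DecidableEq α] in
theorem subsetExpectation_nonneg (hp : p ∈ Set.Icc (0 : ℝ) 1) {f : Finset α → ℝ}
    (h : ∀ s, 0 ≤ f s) : 0 ≤ subsetExpectation p N f := by
  simpa [subsetExpectation_const] using
    subsetExpectation_mono (N := N) hp (f := fun _ => 0) fun s _ => h s

omit [DecidableEq α] in
theorem subsetExpectation_pos (hp : p ∈ Set.Ioo (0 : ℝ) 1) {f : Finset α → ℝ}
    (h : ∀ s, 0 ≤ f s) {s : Finset α} (hs : s ⊆ N) (hfs : 0 < f s) :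
    0 < subsetExpectation p N f := by
  have h1 : 0 < 1 - p := sub_pos.mpr hp.2
  have h0 := hp.1
  refine Finset.sum_pos' (fun t _ => mul_nonneg (by positivity) (h t))
    ⟨s, Finset.mem_powerset.mpr hs, by positivity⟩

theorem subsetExpectation_insert {a : α} (ha : a ∉ N) (f : Finset α → ℝ) :
    subsetExpectation p (insert a N) f =
      subsetExpectation p N fun s => (1 - p) * f s + p * f (insert a s) := by
  rw [subsetExpectation, Finset.sum_powerset_insert ha, ← Finset.sum_add_distrib]
  refine Finset.sum_congr rfl fun s hs => ?_
  have hsN := Finset.mem_powerset.mp hs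
  rw [Finset.card_insert_of_notMem ha, Finset.card_insert_of_notMem fun h => ha (hsN h),
    Nat.add_sub_add_right, Nat.sub_add_comm (Finset.card_le_card hsN)]
  ring

omit [DecidableEq α] in
theorem subsetExpectation_one_div_card_add_one :
    subsetExpectation p N (fun s => 1 / ((s.card : ℝ) + 1)) = binomialInvMoment N.card p := by
  have h := Finset.sum_powerset_apply_card
    (fun k => p ^ k * (1 - p) ^ (N.card - k) * (1 / ((k : ℝ) + 1))) (x := N)
  rw [subsetExpectation, h, binomialInvMoment]
  exact Finset.sum_congr rfl fun k _ => by rw [nsmul_eq_mul]; ring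

omit [DecidableEq α] in
theorem subsetExpectation_map (σ : Equiv.Perm α) (hσ : N.map σ.toEmbedding = N)
    (f : Finset α → ℝ) :
    subsetExpectation p N (fun s => f (s.map σ.toEmbedding)) = subsetExpectation p N f := by
  refine Finset.sum_equiv σ.finsetCongr (fun s => ?_) fun s _ => ?_
  · rw [Equiv.finsetCongr_apply, Finset.mem_powerset, Finset.mem_powerset]
    nth_rewrite 2 [← hσ]
    exact Finset.map_subset_map.symm
  · rw [Equiv.finsetCongr_apply, Finset.card_map]

omit [DecidableEq α] in
theorem sq_subsetExpectation_le (hp : p ∈ Set.Icc (0 : ℝ) 1) (f : Finset α → ℝ) :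
    subsetExpectation p N f * subsetExpectation p N f ≤
      subsetExpectation p N fun s => f s * f s := by
  set m := subsetExpectation p N f with hm
  have h : 0 ≤ subsetExpectation p N fun s => (f s - m) * (f s - m) :=
    subsetExpectation_nonneg hp fun s => mul_self_nonneg _
  have h2 : (fun s => (f s - m) * (f s - m)) = fun s => f s * f s - (2 * m) * f s + m * m := by
    ext s; ring
  rw [h2, subsetExpectation_add, subsetExpectation_sub, subsetExpectation_const_mul,
    subsetExpectation_const, ← hm] at h
  linarith

omit [DecidableEq α] in
theorem subsetCovariance_self_nonneg (hp : p ∈ Set.Icc (0 : ℝ) 1) (f : Finset α → ℝ) :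
    0 ≤ subsetCovariance p N f f := sub_nonneg.mpr (sq_subsetExpectation_le hp f)

omit [DecidableEq α] in
theorem subsetCovariance_comm (f g : Finset α → ℝ) :
    subsetCovariance p N f g = subsetCovariance p N g f := by
  simp only [subsetCovariance, mul_comm]

omit [DecidableEq α] in
theorem subsetCovariance_const (f : Finset α → ℝ) (c : ℝ) :
    subsetCovariance p N f (fun _ => c) = 0 := by
  have : (fun s => f s * c) = fun s => c * f s := by ext; ring
  rw [subsetCovariance, subsetExpectation_const, this, subsetExpectation_const_mul]
  ring

omit [DecidableEq α] in
theorem subsetCovariance_sum {β : Type*} (t : Finset β) (f : Finset α → ℝ)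
    (g : β → Finset α → ℝ) :
    subsetCovariance p N f (fun s => ∑ b ∈ t, g b s) = ∑ b ∈ t, subsetCovariance p N f (g b) := by
  simp only [subsetCovariance, Finset.mul_sum, subsetExpectation_sum, Finset.sum_sub_distrib]

omit [DecidableEq α] in
theorem subsetCovariance_add (f g h : Finset α → ℝ) :
    subsetCovariance p N f (fun s => g s + h s) =
      subsetCovariance p N f g + subsetCovariance p N f h := by
  simp only [subsetCovariance, mul_add, subsetExpectation_add]
  ring

omit [DecidableEq α] in
theorem subsetCovariance_map (σ : Equiv.Perm α) (hσ : N.map σ.toEmbedding = N)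
    (f g : Finset α → ℝ) :
    subsetCovariance p N (fun s => f (s.map σ.toEmbedding)) (fun s => g (s.map σ.toEmbedding)) =
      subsetCovariance p N f g := by
  rw [subsetCovariance, subsetCovariance, subsetExpectation_map σ hσ f,
    subsetExpectation_map σ hσ g, subsetExpectation_map σ hσ fun s => f s * g s]

section AveragingWeight

variable {i : α}

theorem averagingWeight_nonneg (i j : α) (s : Finset α) : 0 ≤ averagingWeight i j s := by
  unfold averagingWeight
  split_ifs <;> positivity

theorem averagingWeight_self (i : α) (s : Finset α) :
    averagingWeight i i s = 1 / ((s.card : ℝ) + 1) := if_pos (Finset.mem_insert_self i s)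

theorem averagingWeight_eq_zero {j : α} (hj : j ∉ insert i N) {s : Finset α} (hs : s ⊆ N) :
    averagingWeight i j s = 0 := if_neg fun h => hj (Finset.insert_subset_insert i hs h)

theorem sum_averagingWeight [Fintype α] {s : Finset α} (hi : i ∉ s) :
    ∑ j, averagingWeight i j s = 1 := by
  simp only [averagingWeight]
  rw [Finset.sum_ite_mem, Finset.univ_inter, Finset.sum_const, Finset.card_insert_of_notMem hi,
    nsmul_eq_mul]
  push_cast
  field_simp

theorem sum_averagingWeight_insert {s : Finset α} (hi : i ∉ N) (hs : s ⊆ N) :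
    averagingWeight i i s + ∑ j ∈ N, averagingWeight i j s = 1 := by
  rw [← Finset.sum_insert hi (f := fun j => averagingWeight i j s)]
  simp only [averagingWeight]
  rw [Finset.sum_ite_mem, Finset.inter_eq_right.mpr (Finset.insert_subset_insert i hs),
    Finset.sum_const, Finset.card_insert_of_notMem fun h => hi (hs h), nsmul_eq_mul]
  push_cast
  field_simp

theorem averagingWeight_map (σ : Equiv.Perm α) (hi : σ i = i) (j : α) (s : Finset α) :
    averagingWeight i (σ j) (s.map σ.toEmbedding) = averagingWeight i j s := by
  have h : σ j ∈ insert i (s.map σ.toEmbedding) ↔ j ∈ insert i s := by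
    rw [Finset.mem_insert, Finset.mem_insert, Finset.mem_map_equiv, Equiv.symm_apply_apply]
    nth_rewrite 1 [← hi]
    rw [σ.injective.eq_iff]
  simp only [averagingWeight, h, Finset.card_map]

theorem subsetCovariance_averagingWeight_perm (σ : Equiv.Perm α)
    (hσ : N.map σ.toEmbedding = N) (hi : σ i = i) (j k : α) :
    subsetCovariance p N (averagingWeight i (σ j)) (averagingWeight i (σ k)) =
      subsetCovariance p N (averagingWeight i j) (averagingWeight i k) := by
  rw [← subsetCovariance_map σ hσ]
  congr 1 <;> (ext s; exact averagingWeight_map σ hi _ s)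

theorem map_swap_eq_self {b c : α} (hb : b ∈ N) (hc : c ∈ N) :
    N.map (Equiv.swap b c).toEmbedding = N := by
  ext x
  rw [Finset.mem_map_equiv, Equiv.symm_swap]
  by_cases hxb : x = b
  · simp [hxb, hb, hc]
  · by_cases hxc : x = c
    · simp [hxc, hb, hc]
    · rw [Equiv.swap_apply_of_ne_of_ne hxb hxc]

theorem subsetCovariance_averagingWeight_one (hi : i ∉ N) (f : Finset α → ℝ) :
    subsetCovariance p N f (averagingWeight i i) +
      ∑ j ∈ N, subsetCovariance p N f (averagingWeight i j) = 0 := by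
  rw [← subsetCovariance_sum, ← subsetCovariance_add, ← subsetCovariance_const (p := p) (N := N)
    f 1, subsetCovariance, subsetCovariance]
  congr 1
  · exact subsetExpectation_congr fun s hs => by rw [sum_averagingWeight_insert hi hs]
  · congr 1
    exact subsetExpectation_congr fun s hs => by rw [sum_averagingWeight_insert hi hs]

/-- Swapping neighbours preserves the law, so these covariances are equal for all `e ∈ N`; as the
weights sum to one, they add up to minus the variance of the own weight. -/
theorem subsetCovariance_averagingWeight_self_nonpos (hp : p ∈ Set.Icc (0 : ℝ) 1) (hi : i ∉ N)
    {e : α} (he : e ∈ N) :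
    subsetCovariance p N (averagingWeight i i) (averagingWeight i e) ≤ 0 := by
  have h1 := subsetCovariance_averagingWeight_one (p := p) hi (averagingWeight i i)
  have h2 : ∀ b ∈ N, subsetCovariance p N (averagingWeight i i) (averagingWeight i b) =
      subsetCovariance p N (averagingWeight i i) (averagingWeight i e) := by
    intro b hb
    have hib : Equiv.swap b e i = i := Equiv.swap_apply_of_ne_of_ne
      (fun h => hi (h ▸ hb)) (fun h => hi (h ▸ he))
    have := subsetCovariance_averagingWeight_perm (p := p) (Equiv.swap b e)
      (map_swap_eq_self hb he) hib i b
    rw [hib, Equiv.swap_apply_left] at this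
    exact this.symm
  rw [Finset.sum_congr rfl h2, Finset.sum_const, nsmul_eq_mul] at h1
  have h3 := subsetCovariance_self_nonneg (N := N) hp (averagingWeight i i)
  have h4 : (0 : ℝ) < N.card := by exact_mod_cast Finset.card_pos.mpr ⟨e, he⟩
  nlinarith

/-- The weight given to a neighbour is positively correlated with its sum with the own weight. -/
theorem subsetCovariance_averagingWeight_add_self_nonneg (hp : p ∈ Set.Icc (0 : ℝ) 1)
    (hi : i ∉ N) {c : α} (hc : c ∈ N) :
    0 ≤ subsetCovariance p N (averagingWeight i c)
      (fun s => averagingWeight i c s + averagingWeight i i s) := by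
  -- Condition on the presence of `c`: if present, both weights are `g`; if absent, the weight of
  -- `c` is zero and the own weight is at most `2 g`. The covariance is then at least `2 p` times
  -- the variance of `g`.
  obtain ⟨N', hcN', rfl⟩ : ∃ N', c ∉ N' ∧ insert c N' = N :=
    ⟨N.erase c, Finset.notMem_erase c N, Finset.insert_erase hc⟩
  have hic : c ≠ i := fun h => hi (h ▸ hc)
  let g : Finset α → ℝ := fun s => 1 / ((s.card : ℝ) + 2)
  have hc0 : ∀ s ⊆ N', averagingWeight i c s = 0 := fun s hs => if_neg fun h => by
    rcases Finset.mem_insert.mp h with h | h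
    exacts [hic h, hcN' (hs h)]
  have hcard : ∀ s ⊆ N', (((insert c s).card : ℝ) + 1) = s.card + 2 := fun s hs => by
    rw [Finset.card_insert_of_notMem fun h => hcN' (hs h)]
    push_cast; ring
  have hc1 : ∀ s ⊆ N', averagingWeight i c (insert c s) = g s := fun s hs => by
    rw [averagingWeight, if_pos (by simp), hcard s hs]
  have hi1 : ∀ s ⊆ N', averagingWeight i i (insert c s) = g s := fun s hs => by
    rw [averagingWeight_self, hcard s hs]
  have e1 : subsetExpectation p (insert c N') (fun s => averagingWeight i c s *
      (averagingWeight i c s + averagingWeight i i s)) =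
      (2 * p) * subsetExpectation p N' fun s => g s * g s := by
    rw [subsetExpectation_insert hcN', ← subsetExpectation_const_mul]
    refine subsetExpectation_congr fun s hs => ?_
    rw [hc0 s hs, hc1 s hs, hi1 s hs]
    ring
  have e2 : subsetExpectation p (insert c N') (averagingWeight i c) =
      p * subsetExpectation p N' g := by
    rw [subsetExpectation_insert hcN', ← subsetExpectation_const_mul]
    refine subsetExpectation_congr fun s hs => ?_
    rw [hc0 s hs, hc1 s hs]
    ring
  have e3 : subsetExpectation p (insert c N')
      (fun s => averagingWeight i c s + averagingWeight i i s) ≤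
      2 * subsetExpectation p N' g := by
    rw [subsetExpectation_insert hcN', ← subsetExpectation_const_mul]
    refine subsetExpectation_mono hp fun s hs => ?_
    rw [hc0 s hs, hc1 s hs, hi1 s hs, averagingWeight_self]
    have h1 : 1 / ((s.card : ℝ) + 1) ≤ 2 * g s := by
      simp only [g]
      rw [mul_one_div, div_le_div_iff₀ (by positivity) (by positivity)]
      linarith [(Nat.cast_nonneg s.card : (0 : ℝ) ≤ s.card)]
    nlinarith [hp.1, hp.2]
  have hg : 0 ≤ subsetExpectation p N' g := subsetExpectation_nonneg hp fun s => by positivity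
  have hg2 := sq_subsetExpectation_le (N := N') hp g
  have h4 := mul_le_mul_of_nonneg_left e3 (mul_nonneg hp.1 hg)
  rw [subsetCovariance, e1, e2]
  nlinarith [mul_le_mul_of_nonneg_left hg2 hp.1]

/-- By symmetry the covariances of `c` with the other neighbours are equal, and they add up to minus
the nonnegative covariance of the preceding lemma. -/
theorem subsetCovariance_averagingWeight_nonpos_of_mem (hp : p ∈ Set.Icc (0 : ℝ) 1) (hi : i ∉ N)
    {c e : α} (hc : c ∈ N) (he : e ∈ N) (hce : c ≠ e) :
    subsetCovariance p N (averagingWeight i c) (averagingWeight i e) ≤ 0 := by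
  have h1 := subsetCovariance_averagingWeight_one (p := p) hi (averagingWeight i c)
  have h2 : ∀ b ∈ N.erase c, subsetCovariance p N (averagingWeight i c) (averagingWeight i b) =
      subsetCovariance p N (averagingWeight i c) (averagingWeight i e) := by
    intro b hb
    have hbN := Finset.mem_of_mem_erase hb
    have hib : Equiv.swap b e i = i := Equiv.swap_apply_of_ne_of_ne
      (fun h => hi (h ▸ hbN)) (fun h => hi (h ▸ he))
    have hcb : Equiv.swap b e c = c := Equiv.swap_apply_of_ne_of_ne
      (Finset.ne_of_mem_erase hb).symm hce
    have := subsetCovariance_averagingWeight_perm (p := p) (Equiv.swap b e)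
      (map_swap_eq_self hbN he) hib c b
    rw [hcb, Equiv.swap_apply_left] at this
    exact this.symm
  have h3 := subsetCovariance_averagingWeight_add_self_nonneg hp hi hc
  rw [subsetCovariance_add] at h3
  rw [← Finset.add_sum_erase _ _ hc, Finset.sum_congr rfl h2, Finset.sum_const,
    nsmul_eq_mul] at h1
  have h4 : (0 : ℝ) < (N.erase c).card := by
    exact_mod_cast Finset.card_pos.mpr ⟨e, Finset.mem_erase.mpr ⟨hce.symm, he⟩⟩
  nlinarith

theorem subsetCovariance_eq_zero_of_notMem {j : α} (hj : j ∉ insert i N) (f : Finset α → ℝ) :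
    subsetCovariance p N f (averagingWeight i j) = 0 := by
  rw [← subsetCovariance_const (p := p) (N := N) f 0, subsetCovariance, subsetCovariance]
  congr 1
  · exact subsetExpectation_congr fun s hs => by rw [averagingWeight_eq_zero hj hs]
  · congr 1
    exact subsetExpectation_congr fun s hs => by rw [averagingWeight_eq_zero hj hs]

theorem subsetCovariance_averagingWeight_nonpos (hp : p ∈ Set.Icc (0 : ℝ) 1) (hi : i ∉ N)
    {j k : α} (hjk : j ≠ k) :
    subsetCovariance p N (averagingWeight i j) (averagingWeight i k) ≤ 0 := by
  by_cases hk : k ∈ insert i N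
  swap
  · rw [subsetCovariance_eq_zero_of_notMem hk]
  by_cases hj : j ∈ insert i N
  swap
  · rw [subsetCovariance_comm, subsetCovariance_eq_zero_of_notMem hj]
  rcases Finset.mem_insert.mp hj with hji | hjN
  · rcases Finset.mem_insert.mp hk with hki | hkN
    · exact absurd (hji.trans hki.symm) hjk
    · exact hji ▸ subsetCovariance_averagingWeight_self_nonpos hp hi hkN
  · rcases Finset.mem_insert.mp hk with hki | hkN
    · rw [subsetCovariance_comm, hki]
      exact subsetCovariance_averagingWeight_self_nonpos hp hi hjN
    · exact subsetCovariance_averagingWeight_nonpos_of_mem hp hi hjN hkN hjk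

theorem sum_subsetCovariance_averagingWeight [Fintype α] (hi : i ∉ N) (f : Finset α → ℝ) :
    ∑ k, subsetCovariance p N f (averagingWeight i k) = 0 := by
  rw [← subsetCovariance_averagingWeight_one (p := p) hi f, ← Finset.sum_insert hi
    (f := fun j => subsetCovariance p N f (averagingWeight i j))]
  symm
  exact Finset.sum_subset (Finset.subset_univ _) fun j _ hj =>
    subsetCovariance_eq_zero_of_notMem hj f

/-- The absolute covariances of the weights that a node gives sum up to at most its node term. -/
theorem sum_abs_subsetCovariance_averagingWeight_le [Fintype α] (hp : p ∈ Set.Icc (0 : ℝ) 1)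
    (hi : i ∉ N) :
    ∑ jk : α × α, |subsetCovariance p N (averagingWeight i jk.1) (averagingWeight i jk.2)| ≤
      nodeTerm N.card p := by
  set c : α → α → ℝ := fun j k =>
    subsetCovariance p N (averagingWeight i j) (averagingWeight i k) with hc
  -- Rows of the covariance matrix sum to zero and only the diagonal is nonnegative, so an absolute
  -- row sum is twice the variance.
  have hrow : ∀ j, ∑ k, |c j k| = 2 * c j j := by
    intro j
    have h0 : c j j + ∑ k ∈ Finset.univ.erase j, c j k = 0 := by
      rw [Finset.add_sum_erase _ _ (Finset.mem_univ j)]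
      exact sum_subsetCovariance_averagingWeight hi _
    have h1 : ∑ k ∈ Finset.univ.erase j, |c j k| = ∑ k ∈ Finset.univ.erase j, -c j k :=
      Finset.sum_congr rfl fun k hk => abs_of_nonpos
        (subsetCovariance_averagingWeight_nonpos hp hi (Finset.ne_of_mem_erase hk).symm)
    rw [← Finset.add_sum_erase _ _ (Finset.mem_univ j), h1, Finset.sum_neg_distrib,
      abs_of_nonneg (subsetCovariance_self_nonneg hp _)]
    linarith
  set M := binomialInvMoment N.card p with hM
  set m : α → ℝ := fun j => subsetExpectation p N (averagingWeight i j) with hm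
  have hmi : m i = M := by
    rw [hM, ← subsetExpectation_one_div_card_add_one (N := N)]
    exact subsetExpectation_congr fun s _ => averagingWeight_self i s
  have hsum : ∑ j ∈ N, m j = 1 - M := by
    have h1 : m i + ∑ j ∈ N, m j = 1 := by
      rw [← subsetExpectation_sum, ← subsetExpectation_add,
        ← subsetExpectation_const (p := p) (N := N) 1]
      exact subsetExpectation_congr fun s hs => sum_averagingWeight_insert hi hs
    linarith
  -- Cauchy–Schwarz; for empty `N` the quotient is zero by convention.
  have hsq : (1 - M) ^ 2 / N.card ≤ ∑ j ∈ N, m j ^ 2 := by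
    refine div_le_of_le_mul₀ (Nat.cast_nonneg _) (Finset.sum_nonneg fun j _ => sq_nonneg _) ?_
    rw [← hsum, mul_comm]
    exact sq_sum_le_card_mul_sum_sq
  have hvar : ∑ j, c j j ≤ M - M ^ 2 - ∑ j ∈ N, m j ^ 2 := by
    have h1 : ∑ j, subsetExpectation p N (fun s => averagingWeight i j s * averagingWeight i j s)
        = M := by
      rw [← hmi, ← subsetExpectation_sum]
      refine subsetExpectation_congr fun s hs => ?_
      -- Every weight is either zero or equal to the own weight, so the squares sum to the own
      -- weight.
      have h2 : ∀ j, averagingWeight i j s * averagingWeight i j s =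
          averagingWeight i i s * averagingWeight i j s := by
        intro j
        rw [averagingWeight_self]
        unfold averagingWeight
        split_ifs <;> simp
      rw [Finset.sum_congr rfl fun j _ => h2 j, ← Finset.mul_sum,
        sum_averagingWeight fun h => hi (hs h), mul_one]
    have h2 : M ^ 2 + ∑ j ∈ N, m j ^ 2 ≤ ∑ j, m j ^ 2 := by
      rw [← hmi, ← Finset.sum_insert hi (f := fun j => m j ^ 2)]
      exact Finset.sum_le_sum_of_subset_of_nonneg (Finset.subset_univ _)
        fun j _ _ => sq_nonneg _
    have h3 : ∑ j, c j j = M - ∑ j, m j ^ 2 := by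
      rw [← h1, ← Finset.sum_sub_distrib]
      exact Finset.sum_congr rfl fun j _ => by rw [sq]; rfl
    linarith
  have hterm : nodeTerm N.card p = 2 * (M - M ^ 2 - (1 - M) ^ 2 / N.card) := by
    rw [nodeTerm, ← hM]
    ring
  rw [Fintype.sum_prod_type, Finset.sum_congr rfl fun j _ => hrow j, ← Finset.mul_sum, hterm]
  linarith

end AveragingWeight

end RandomSubset

/-! ### The weight matrix in terms of in-neighbours. -/

section WeightMatrix

variable {n : ℕ}

open Classical in
/-- The set of in-neighbours of the node `i`. -/
noncomputable def inNeighbors (H : Digraph (Fin n)) (i : Fin n) : Finset (Fin n) :=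
  Finset.univ.filter fun u => H.Adj u i

theorem mem_inNeighbors {H : Digraph (Fin n)} {i u : Fin n} : u ∈ inNeighbors H i ↔ H.Adj u i := by
  simp [inNeighbors]

theorem digraphInDegree_eq_card (H : Digraph (Fin n)) (i : Fin n) :
    digraphInDegree H i = (inNeighbors H i).card := by
  simp [digraphInDegree, digraphAdjMatrix, inNeighbors]

/-- A loop at `i` has to be excluded: the added identity would count it twice. -/
theorem weightMatrix_apply {H : Digraph (Fin n)} {i : Fin n} (hi : ¬ H.Adj i i) (j : Fin n) :
    weightMatrix H i j = averagingWeight i j (inNeighbors H i) := by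
  have h1 : (Matrix.diagonal (digraphInDegree H) + 1 : Matrix (Fin n) (Fin n) ℝ) =
      Matrix.diagonal fun v => ((inNeighbors H v).card : ℝ) + 1 := by
    rw [← Matrix.diagonal_one, Matrix.diagonal_add]
    simp only [digraphInDegree_eq_card]
  have h2 : (Matrix.diagonal fun v => ((inNeighbors H v).card : ℝ) + 1 :
      Matrix (Fin n) (Fin n) ℝ)⁻¹ =
      Matrix.diagonal fun v => (((inNeighbors H v).card : ℝ) + 1)⁻¹ := by
    refine Matrix.inv_eq_left_inv ?_
    rw [Matrix.diagonal_mul_diagonal, ← Matrix.diagonal_one]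
    congr 1
    ext v
    exact inv_mul_cancel₀ (by positivity)
  have h3 : j ∈ insert i (inNeighbors H i) ↔ j = i ∨ H.Adj j i := by
    rw [Finset.mem_insert, mem_inNeighbors]
  rw [weightMatrix, h1, h2, Matrix.diagonal_mul, averagingWeight, Matrix.transpose_apply,
    Matrix.add_apply, digraphAdjMatrix, Matrix.of_apply, Matrix.one_apply]
  by_cases hji : j = i
  · rw [if_pos (h3.mpr (Or.inl hji)), if_pos hji, if_neg (hji ▸ hi), zero_add, mul_one, one_div]
  · by_cases hadj : H.Adj j i
    · rw [if_pos (h3.mpr (Or.inr hadj)), if_neg hji, if_pos hadj, add_zero, mul_one, one_div]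
    · rw [if_neg fun h => (h3.mp h).elim hji hadj, if_neg hji, if_neg hadj, add_zero, mul_zero]

end WeightMatrix

/-! ### Independence of edges and the law of the in-neighbours. -/

section SwitchingDigraph

variable {n : ℕ} {Ω : Type*} [MeasurableSpace Ω] {μ : Measure Ω}
  {G : SimpleGraph (Fin n)} {p : Fin n → ℝ} {𝒢 : ℕ → Ω → Digraph (Fin n)}

open Classical in
/-- The indicator of the presence of the directed edge `(e.2.1, e.2.2)` in the time slot `e.1`. -/
noncomputable def edgeIndicator (𝒢 : ℕ → Ω → Digraph (Fin n)) (e : ℕ × Fin n × Fin n) (ω : Ω) :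
    Bool := decide ((𝒢 e.1 ω).Adj e.2.1 e.2.2)

/-- The random variable `f` is a function of the presence of the edges in `S`. -/
def DependsOnEdges (𝒢 : ℕ → Ω → Digraph (Fin n)) (S : Finset (ℕ × Fin n × Fin n)) (f : Ω → ℝ) :
    Prop :=
  ∀ ω ω', (∀ e ∈ S, edgeIndicator 𝒢 e ω = edgeIndicator 𝒢 e ω') → f ω = f ω'

-- Factoring through the finite type `S → Bool` is what later gives measurability, boundedness and
-- independence.
omit [MeasurableSpace Ω] in
theorem DependsOnEdges.exists_eq_comp {S : Finset (ℕ × Fin n × Fin n)} {f : Ω → ℝ}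
    (hf : DependsOnEdges 𝒢 S f) :
    ∃ F : (S → Bool) → ℝ, f = F ∘ fun ω (e : S) => edgeIndicator 𝒢 e ω :=
  (Function.factorsThrough_iff f).mp fun ω ω' h => hf ω ω' fun e he => congrFun h ⟨e, he⟩

omit [MeasurableSpace Ω] in
theorem DependsOnEdges.mul {S : Finset (ℕ × Fin n × Fin n)} {f g : Ω → ℝ}
    (hf : DependsOnEdges 𝒢 S f) (hg : DependsOnEdges 𝒢 S g) :
    DependsOnEdges 𝒢 S fun ω => f ω * g ω := fun ω ω' h => by
  simp only [hf ω ω' h, hg ω ω' h]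

omit [MeasurableSpace Ω] in
theorem DependsOnEdges.mono {S T : Finset (ℕ × Fin n × Fin n)} {f : Ω → ℝ}
    (hf : DependsOnEdges 𝒢 S f) (h : S ⊆ T) : DependsOnEdges 𝒢 T f :=
  fun ω ω' h' => hf ω ω' fun e he => h' e (h he)

namespace IsSwitchingDigraphProcess

theorem measurable_edgeIndicator (h : IsSwitchingDigraphProcess G p μ 𝒢)
    (e : ℕ × Fin n × Fin n) : Measurable (edgeIndicator 𝒢 e) := by
  refine measurable_to_bool ?_
  have : edgeIndicator 𝒢 e ⁻¹' {true} = {ω | (𝒢 e.1 ω).Adj e.2.1 e.2.2} := by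
    ext ω; simp [edgeIndicator]
  rw [this]
  exact h.measurableSet_adj _ _ _

theorem iIndepFun_edgeIndicator (h : IsSwitchingDigraphProcess G p μ 𝒢) :
    iIndepFun (edgeIndicator 𝒢) μ := by
  have h1 := (h.indep_adj.iIndepFun_indicator (β := ℝ)).comp
    (fun _ x => decide (x = 1)) fun _ => measurable_to_bool (by
      have : (fun x : ℝ => decide (x = 1)) ⁻¹' {true} = {1} := by ext; simp
      rw [this]
      exact measurableSet_singleton 1)
  convert! h1 using 1
  ext e ω
  by_cases hω : (𝒢 e.1 ω).Adj e.2.1 e.2.2 <;> simp [edgeIndicator, hω]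

theorem measurable_of_dependsOnEdges (h : IsSwitchingDigraphProcess G p μ 𝒢)
    {S : Finset (ℕ × Fin n × Fin n)} {f : Ω → ℝ} (hf : DependsOnEdges 𝒢 S f) : Measurable f := by
  obtain ⟨F, rfl⟩ := hf.exists_eq_comp
  exact (measurable_of_countable F).comp
    (measurable_pi_lambda _ fun e => h.measurable_edgeIndicator e)

theorem integrable_of_dependsOnEdges [IsProbabilityMeasure μ]
    (h : IsSwitchingDigraphProcess G p μ 𝒢) {S : Finset (ℕ × Fin n × Fin n)} {f : Ω → ℝ}
    (hf : DependsOnEdges 𝒢 S f) : Integrable f μ := by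
  have hm := h.measurable_of_dependsOnEdges hf
  obtain ⟨F, rfl⟩ := hf.exists_eq_comp
  obtain ⟨C, hC⟩ := (Set.finite_range fun x => ‖F x‖).bddAbove
  exact Integrable.of_bound hm.aestronglyMeasurable C
    (ae_of_all _ fun ω => hC ⟨_, rfl⟩)

theorem integral_mul_of_dependsOnEdges (h : IsSwitchingDigraphProcess G p μ 𝒢)
    {S T : Finset (ℕ × Fin n × Fin n)} (hST : Disjoint S T) {f g : Ω → ℝ}
    (hf : DependsOnEdges 𝒢 S f) (hg : DependsOnEdges 𝒢 T g) :
    ∫ ω, f ω * g ω ∂μ = (∫ ω, f ω ∂μ) * ∫ ω, g ω ∂μ := by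
  have hfm := h.measurable_of_dependsOnEdges hf
  have hgm := h.measurable_of_dependsOnEdges hg
  obtain ⟨F, rfl⟩ := hf.exists_eq_comp
  obtain ⟨F', rfl⟩ := hg.exists_eq_comp
  have hi := (h.iIndepFun_edgeIndicator.indepFun_finset S T hST h.measurable_edgeIndicator).comp
    (measurable_of_countable F) (measurable_of_countable F')
  exact hi.integral_fun_mul_eq_mul_integral hfm.aestronglyMeasurable hgm.aestronglyMeasurable

theorem inNeighbors_subset [DecidableRel G.Adj] (h : IsSwitchingDigraphProcess G p μ 𝒢) (k : ℕ)
    (ω : Ω) (i : Fin n) : inNeighbors (𝒢 k ω) i ⊆ G.neighborFinset i := fun u hu => by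
  rw [SimpleGraph.mem_neighborFinset]
  exact (h.adj_of_adj k ω u i (mem_inNeighbors.mp hu)).symm

theorem measurableSet_inNeighbors_eq (h : IsSwitchingDigraphProcess G p μ 𝒢) (k : ℕ) (i : Fin n)
    (s : Finset (Fin n)) : MeasurableSet {ω | inNeighbors (𝒢 k ω) i = s} := by
  have : {ω | inNeighbors (𝒢 k ω) i = s} = ⋂ u, {ω | (𝒢 k ω).Adj u i ↔ u ∈ s} := by
    ext ω; simp [Finset.ext_iff, mem_inNeighbors]
  rw [this]
  refine MeasurableSet.iInter fun u => ?_
  by_cases hu : u ∈ s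
  · simpa [hu] using h.measurableSet_adj k u i
  · have : {ω | (𝒢 k ω).Adj u i ↔ u ∈ s} = {ω | (𝒢 k ω).Adj u i}ᶜ := by
      ext ω; simp [hu]
    rw [this]
    exact (h.measurableSet_adj k u i).compl

/-- The law of the set of in-neighbours. -/
theorem measureReal_inNeighbors_eq [IsProbabilityMeasure μ] [DecidableRel G.Adj]
    (h : IsSwitchingDigraphProcess G p μ 𝒢) (hp : ∀ v, p v ∈ Set.Ioo (0 : ℝ) 1) (k : ℕ)
    (i : Fin n) {s : Finset (Fin n)} (hs : s ⊆ G.neighborFinset i) :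
    μ.real {ω | inNeighbors (𝒢 k ω) i = s} =
      p i ^ s.card * (1 - p i) ^ ((G.neighborFinset i).card - s.card) := by
  set N := G.neighborFinset i with hN
  let e : Fin n ↪ ℕ × Fin n × Fin n := ⟨fun u => (k, u, i), fun u v huv => by simpa using huv⟩
  have he : ∀ u, e u = (k, u, i) := fun _ => rfl
  -- Only edges from neighbours in `G` need to be tested, since no others ever occur.
  have hset : {ω | inNeighbors (𝒢 k ω) i = s} =
      ⋂ x ∈ N.map e, edgeIndicator 𝒢 x ⁻¹' {decide (x.2.1 ∈ s)} := by
    ext ω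
    have hsub := h.inNeighbors_subset k ω i
    simp only [Set.mem_ofPred_eq, Finset.mem_map, Set.iInter_exists, Set.biInter_and',
      Set.iInter_iInter_eq_right, Set.mem_iInter, Set.mem_preimage, Set.mem_singleton_iff]
    constructor
    · rintro rfl u -
      simp [edgeIndicator, he, mem_inNeighbors]
    · intro hall
      ext u
      by_cases hu : u ∈ N
      · have := hall u hu
        simpa [edgeIndicator, he, mem_inNeighbors] using this
      · exact ⟨fun hu' => absurd (hsub hu') hu, fun hu' => absurd (hs hu') hu⟩
  have hprob : ∀ u ∈ N, μ.real (edgeIndicator 𝒢 (e u) ⁻¹' {decide (u ∈ s)}) =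
      if u ∈ s then p i else 1 - p i := by
    intro u hu
    have hadj : G.Adj u i := ((SimpleGraph.mem_neighborFinset _ _ _).mp hu).symm
    have h1 : μ.real {ω | (𝒢 k ω).Adj u i} = p i := by
      rw [Measure.real, h.measure_adj k u i hadj, ENNReal.toReal_ofReal (hp i).1.le]
    by_cases hus : u ∈ s
    · have : edgeIndicator 𝒢 (e u) ⁻¹' {decide (u ∈ s)} = {ω | (𝒢 k ω).Adj u i} := by
        ext ω; simp [edgeIndicator, he, hus]
      rw [this, h1, if_pos hus]
    · have : edgeIndicator 𝒢 (e u) ⁻¹' {decide (u ∈ s)} = {ω | (𝒢 k ω).Adj u i}ᶜ := by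
        ext ω; simp [edgeIndicator, he, hus]
      rw [this, probReal_compl_eq_one_sub (h.measurableSet_adj k u i), h1, if_neg hus]
  have hmul := h.iIndepFun_edgeIndicator.measure_inter_preimage_eq_mul (N.map e)
    (sets := fun x => {decide (x.2.1 ∈ s)}) fun x _ => measurableSet_singleton _
  rw [hset, Measure.real, hmul, ENNReal.toReal_prod, Finset.prod_map]
  have h2 : ∏ u ∈ N, (μ (edgeIndicator 𝒢 (e u) ⁻¹' {decide ((e u).2.1 ∈ s)})).toReal =
      ∏ u ∈ N, if u ∈ s then p i else 1 - p i := Finset.prod_congr rfl hprob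
  rw [h2, Finset.prod_ite, Finset.prod_const, Finset.prod_const, Finset.filter_mem_eq_inter,
    Finset.inter_eq_right.mpr hs, Finset.filter_notMem_eq_sdiff, Finset.card_sdiff_of_subset hs]

/-- The expectation of a function of the in-neighbours. -/
theorem integral_inNeighbors [IsProbabilityMeasure μ] [DecidableRel G.Adj]
    (h : IsSwitchingDigraphProcess G p μ 𝒢) (hp : ∀ v, p v ∈ Set.Ioo (0 : ℝ) 1) (k : ℕ)
    (i : Fin n) (f : Finset (Fin n) → ℝ) :
    ∫ ω, f (inNeighbors (𝒢 k ω) i) ∂μ = subsetExpectation (p i) (G.neighborFinset i) f := by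
  have h1 : ∀ ω, f (inNeighbors (𝒢 k ω) i) = ∑ s ∈ (G.neighborFinset i).powerset,
      {ω | inNeighbors (𝒢 k ω) i = s}.indicator (fun _ => f s) ω := by
    intro ω
    rw [Finset.sum_eq_single (inNeighbors (𝒢 k ω) i)]
    · simp
    · intro s _ hs
      simp [hs.symm]
    · intro hs
      exact absurd (Finset.mem_powerset.mpr (h.inNeighbors_subset k ω i)) hs
  simp only [h1]
  rw [integral_finsetSum _ fun s _ =>
    (integrable_const (f s)).indicator (h.measurableSet_inNeighbors_eq k i s)]
  refine Finset.sum_congr rfl fun s hs => ?_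
  rw [integral_indicator_const _ (h.measurableSet_inNeighbors_eq k i s),
    h.measureReal_inNeighbors_eq hp k i (Finset.mem_powerset.mp hs), smul_eq_mul]

theorem not_adj_self (h : IsSwitchingDigraphProcess G p μ 𝒢) (k : ℕ) (ω : Ω) (i : Fin n) :
    ¬ (𝒢 k ω).Adj i i := fun hi => G.irrefl (h.adj_of_adj k ω i i hi)

theorem weightMatrix_apply (h : IsSwitchingDigraphProcess G p μ 𝒢) (k : ℕ) (ω : Ω)
    (i j : Fin n) :
    weightMatrix (𝒢 k ω) i j = averagingWeight i j (inNeighbors (𝒢 k ω) i) :=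
  _root_.weightMatrix_apply (h.not_adj_self k ω i) j

theorem weightMatrix_nonneg (h : IsSwitchingDigraphProcess G p μ 𝒢) (k : ℕ) (ω : Ω)
    (i j : Fin n) : 0 ≤ weightMatrix (𝒢 k ω) i j := by
  rw [h.weightMatrix_apply]
  exact averagingWeight_nonneg _ _ _

theorem sum_weightMatrix (h : IsSwitchingDigraphProcess G p μ 𝒢) (k : ℕ) (ω : Ω)
    (i : Fin n) : ∑ j, weightMatrix (𝒢 k ω) i j = 1 := by
  simp only [h.weightMatrix_apply]
  exact sum_averagingWeight fun hi => h.not_adj_self k ω i (mem_inNeighbors.mp hi)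

/-- The edges into the node `i` in the time slot `k`. -/
def edgesInto (k : ℕ) (i : Fin n) : Finset (ℕ × Fin n × Fin n) :=
  {k} ×ˢ Finset.univ ×ˢ {i}

theorem dependsOnEdges_weightMatrix (h : IsSwitchingDigraphProcess G p μ 𝒢) (k : ℕ)
    (i j : Fin n) : DependsOnEdges 𝒢 (edgesInto k i) fun ω => weightMatrix (𝒢 k ω) i j := by
  intro ω ω' hω
  have : inNeighbors (𝒢 k ω) i = inNeighbors (𝒢 k ω') i := by
    ext u
    have := hω (k, u, i) (by simp [edgesInto])
    simpa [edgeIndicator, mem_inNeighbors] using this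
  simp only [h.weightMatrix_apply, this]

theorem dependsOnEdges_consensusState (h : IsSwitchingDigraphProcess G p μ 𝒢) (x₀ : Fin n → ℝ)
    (k : ℕ) (i : Fin n) :
    DependsOnEdges 𝒢 (Finset.range k ×ˢ Finset.univ)
      fun ω => consensusState (fun j => 𝒢 j ω) x₀ k i := by
  induction k generalizing i with
  | zero => exact fun ω ω' _ => rfl
  | succ k ih =>
    intro ω ω' hω
    simp only [consensusState, Matrix.mulVec, dotProduct]
    refine Finset.sum_congr rfl fun j _ => ?_
    have h1 := h.dependsOnEdges_weightMatrix k i j ω ω' fun e he => hω e (by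
      simp only [edgesInto, Finset.mem_product, Finset.mem_singleton] at he
      simp [he.1])
    have h2 := ih j ω ω' fun e he => hω e (by
      simp only [Finset.mem_product, Finset.mem_range, Finset.mem_univ, and_true] at he ⊢
      omega)
    exact congrArg₂ (· * ·) h1 h2

end IsSwitchingDigraphProcess

end SwitchingDigraph

/-! ### First and second moments of the weight matrix. -/

section MomentMatrices

variable {n : ℕ}

/-- The expected weight matrix, computed from the graph of potential edges. -/
noncomputable def meanWeight (G : SimpleGraph (Fin n)) [DecidableRel G.Adj] (p : Fin n → ℝ) :
    Matrix (Fin n) (Fin n) ℝ :=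
  Matrix.of fun i j => subsetExpectation (p i) (G.neighborFinset i) (averagingWeight i j)

/-- The expectation of the Kronecker square of the weight matrix. -/
noncomputable def secondMomentWeight (G : SimpleGraph (Fin n)) [DecidableRel G.Adj]
    (p : Fin n → ℝ) : Matrix (Fin n × Fin n) (Fin n × Fin n) ℝ :=
  Matrix.of fun ab cd =>
    if ab.1 = ab.2 then
      subsetExpectation (p ab.1) (G.neighborFinset ab.1)
        fun s => averagingWeight ab.1 cd.1 s * averagingWeight ab.1 cd.2 s
    else meanWeight G p ab.1 cd.1 * meanWeight G p ab.2 cd.2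

variable {Ω : Type*} [MeasurableSpace Ω] {μ : Measure Ω} [IsProbabilityMeasure μ]
  {G : SimpleGraph (Fin n)} [DecidableRel G.Adj] {p : Fin n → ℝ}
  {𝒢 : ℕ → Ω → Digraph (Fin n)}

namespace IsSwitchingDigraphProcess

theorem integral_weightMatrix (h : IsSwitchingDigraphProcess G p μ 𝒢)
    (hp : ∀ v, p v ∈ Set.Ioo (0 : ℝ) 1) (k : ℕ) (i j : Fin n) :
    ∫ ω, weightMatrix (𝒢 k ω) i j ∂μ = meanWeight G p i j := by
  simp only [h.weightMatrix_apply]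
  exact h.integral_inNeighbors hp k i _

theorem expectedWeightMatrix_eq (h : IsSwitchingDigraphProcess G p μ 𝒢)
    (hp : ∀ v, p v ∈ Set.Ioo (0 : ℝ) 1) (k : ℕ) :
    expectedWeightMatrix μ (𝒢 k) = meanWeight G p := by
  ext i j
  exact h.integral_weightMatrix hp k i j

theorem integral_weightMatrix_mul (h : IsSwitchingDigraphProcess G p μ 𝒢)
    (hp : ∀ v, p v ∈ Set.Ioo (0 : ℝ) 1) (k : ℕ) (a b c d : Fin n) :
    ∫ ω, weightMatrix (𝒢 k ω) a c * weightMatrix (𝒢 k ω) b d ∂μ =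
      secondMomentWeight G p (a, b) (c, d) := by
  rw [secondMomentWeight, Matrix.of_apply]
  split_ifs with hab
  · simp only at hab
    subst hab
    simp only [h.weightMatrix_apply]
    exact h.integral_inNeighbors hp k a fun s => averagingWeight a c s * averagingWeight a d s
  -- Distinct rows depend on edges into distinct nodes and are independent.
  · rw [h.integral_mul_of_dependsOnEdges ?_ (h.dependsOnEdges_weightMatrix k a c)
      (h.dependsOnEdges_weightMatrix k b d), h.integral_weightMatrix hp,
      h.integral_weightMatrix hp]
    rw [Finset.disjoint_left]
    intro e he he'
    simp only [edgesInto, Finset.mem_product, Finset.mem_singleton] at he he'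
    exact hab (he.2.2.symm.trans he'.2.2)

/-- Slot `k` is independent of the earlier ones, so second moments evolve linearly. Two initial
conditions are allowed because mixed moments of trajectories from different unit vectors are needed.
-/
theorem integral_consensusState_mul_succ (h : IsSwitchingDigraphProcess G p μ 𝒢)
    (hp : ∀ v, p v ∈ Set.Ioo (0 : ℝ) 1) (x₀ y₀ : Fin n → ℝ) (k : ℕ) (a b : Fin n) :
    ∫ ω, consensusState (fun j => 𝒢 j ω) x₀ (k + 1) a *
        consensusState (fun j => 𝒢 j ω) y₀ (k + 1) b ∂μ =
      ∑ cd : Fin n × Fin n, secondMomentWeight G p (a, b) cd *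
        ∫ ω, consensusState (fun j => 𝒢 j ω) x₀ k cd.1 *
          consensusState (fun j => 𝒢 j ω) y₀ k cd.2 ∂μ := by
  let S : Finset (ℕ × Fin n × Fin n) := {k} ×ˢ Finset.univ
  let T : Finset (ℕ × Fin n × Fin n) := Finset.range k ×ˢ Finset.univ
  have hST : Disjoint S T := by
    rw [Finset.disjoint_left]
    intro e he he'
    simp only [S, T, Finset.mem_product, Finset.mem_singleton, Finset.mem_range] at he he'
    omega
  have hinto : ∀ i : Fin n, edgesInto k i ⊆ S := by
    intro i e he
    simp only [edgesInto, S, Finset.mem_product, Finset.mem_singleton, Finset.mem_univ] at he ⊢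
    exact ⟨he.1, trivial⟩
  have hW : ∀ c d, DependsOnEdges 𝒢 S fun ω =>
      weightMatrix (𝒢 k ω) a c * weightMatrix (𝒢 k ω) b d := fun c d =>
    ((h.dependsOnEdges_weightMatrix k a c).mono (hinto a)).mul
      ((h.dependsOnEdges_weightMatrix k b d).mono (hinto b))
  have hX : ∀ c d, DependsOnEdges 𝒢 T fun ω => consensusState (fun j => 𝒢 j ω) x₀ k c *
      consensusState (fun j => 𝒢 j ω) y₀ k d := fun c d =>
    (h.dependsOnEdges_consensusState x₀ k c).mul (h.dependsOnEdges_consensusState y₀ k d)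
  have hexp : ∀ ω, consensusState (fun j => 𝒢 j ω) x₀ (k + 1) a *
        consensusState (fun j => 𝒢 j ω) y₀ (k + 1) b =
      ∑ cd : Fin n × Fin n, (weightMatrix (𝒢 k ω) a cd.1 * weightMatrix (𝒢 k ω) b cd.2) *
        (consensusState (fun j => 𝒢 j ω) x₀ k cd.1 *
          consensusState (fun j => 𝒢 j ω) y₀ k cd.2) := by
    intro ω
    simp only [consensusState, Matrix.mulVec, dotProduct]
    rw [Finset.sum_mul_sum, Fintype.sum_prod_type]
    exact Finset.sum_congr rfl fun c _ => Finset.sum_congr rfl fun d _ => by ring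
  simp only [hexp]
  rw [integral_finsetSum _ fun cd _ => h.integrable_of_dependsOnEdges (S := S ∪ T)
    (((hW cd.1 cd.2).mono Finset.subset_union_left).mul
      ((hX cd.1 cd.2).mono Finset.subset_union_right))]
  refine Finset.sum_congr rfl fun cd _ => ?_
  rw [h.integral_mul_of_dependsOnEdges hST (hW cd.1 cd.2) (hX cd.1 cd.2),
    h.integral_weightMatrix_mul hp]

end IsSwitchingDigraphProcess

end MomentMatrices

/-! ### Irreducibility of Kronecker squares. -/

namespace Matrix

open Kronecker

variable {ι : Type*} [Fintype ι] {P : Matrix ι ι ℝ}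

theorem IsStochastic.kronecker_self (hP : P.IsStochastic) : (P ⊗ₖ P).IsStochastic := by
  constructor
  · intro i j
    exact mul_nonneg (hP.nonneg _ _) (hP.nonneg _ _)
  · intro i
    simp only [Matrix.kroneckerMap_apply, Fintype.sum_prod_type, ← Finset.mul_sum, hP.row_sum,
      mul_one]

omit [Fintype ι] in
theorem reflTransGen_kronecker_self (hdiag : ∀ i, 0 < P i i)
    (hirr : ∀ i j, Relation.ReflTransGen (fun a b => 0 < P a b) i j) (i j : ι × ι) :
    Relation.ReflTransGen (fun a b => 0 < (P ⊗ₖ P) a b) i j := by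
  have h1 : Relation.ReflTransGen (fun a b => 0 < (P ⊗ₖ P) a b) (i.1, i.2) (j.1, i.2) :=
    (hirr i.1 j.1).lift (fun a => (a, i.2)) fun a b hab => mul_pos hab (hdiag _)
  have h2 : Relation.ReflTransGen (fun a b => 0 < (P ⊗ₖ P) a b) (j.1, i.2) (j.1, j.2) :=
    (hirr i.2 j.2).lift (fun a => (j.1, a)) fun a b hab => mul_pos (hdiag _) hab
  exact h1.trans h2

end Matrix

/-! ### Deterministic convergence to consensus. -/

section Consensus

variable {n : ℕ}

theorem reachesConsensusAt_asymptoticConsensusValue {x : ℕ → Fin n → ℝ}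
    (h : ∃ c, ReachesConsensusAt x c) : ReachesConsensusAt x (asymptoticConsensusValue x) := by
  rw [asymptoticConsensusValue, dif_pos h]
  exact h.choose_spec

theorem consensusState_smul_add {H : ℕ → Digraph (Fin n)} (x₀ : Fin n → ℝ) (k : ℕ) (i : Fin n) :
    consensusState H x₀ k i = ∑ j, x₀ j * consensusState H (Pi.single j 1) k i := by
  induction k generalizing i with
  | zero => simp [consensusState, Pi.single_apply]
  | succ k ih =>
    simp only [consensusState, Matrix.mulVec, dotProduct]
    simp only [ih, Finset.mul_sum]
    rw [Finset.sum_comm]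
    exact Finset.sum_congr rfl fun j _ => Finset.sum_congr rfl fun l _ => by ring

variable {H : ℕ → Digraph (Fin n)} (h0 : ∀ k i j, 0 ≤ weightMatrix (H k) i j)
  (h1 : ∀ k i, ∑ j, weightMatrix (H k) i j = 1)

include h0 h1 in
theorem consensusState_succ_le {x₀ : Fin n → ℝ} {k : ℕ} {C : ℝ}
    (hC : ∀ i, consensusState H x₀ k i ≤ C) (i : Fin n) : consensusState H x₀ (k + 1) i ≤ C := by
  have := Finset.sum_le_sum fun j (_ : j ∈ Finset.univ) =>
    mul_le_mul_of_nonneg_left (hC j) (h0 k i j)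
  rwa [← Finset.sum_mul, h1, one_mul] at this

include h0 h1 in
theorem le_consensusState_succ {x₀ : Fin n → ℝ} {k : ℕ} {C : ℝ}
    (hC : ∀ i, C ≤ consensusState H x₀ k i) (i : Fin n) : C ≤ consensusState H x₀ (k + 1) i := by
  have := Finset.sum_le_sum fun j (_ : j ∈ Finset.univ) =>
    mul_le_mul_of_nonneg_left (hC j) (h0 k i j)
  rwa [← Finset.sum_mul, h1, one_mul] at this

include h0 h1 in
theorem abs_consensusState_le {x₀ : Fin n → ℝ} {C : ℝ} (hC : ∀ i, |x₀ i| ≤ C) (k : ℕ)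
    (i : Fin n) : |consensusState H x₀ k i| ≤ C := by
  rw [abs_le]
  constructor
  · induction k generalizing i with
    | zero => exact (abs_le.mp (hC i)).1
    | succ k ih => exact le_consensusState_succ h0 h1 ih i
  · induction k generalizing i with
    | zero => exact (abs_le.mp (hC i)).2
    | succ k ih => exact consensusState_succ_le h0 h1 ih i

include h0 h1 in
/-- If the differences along the edges of a connected graph vanish in the limit, then the
trajectory reaches consensus. -/
theorem exists_reachesConsensusAt [NeZero n] {G : SimpleGraph (Fin n)} (hG : G.Connected)
    (x₀ : Fin n → ℝ)
    (hedge : ∀ i j, G.Adj i j → Tendsto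
      (fun k => consensusState H x₀ k i - consensusState H x₀ k j) atTop (𝓝 0)) :
    ∃ c, ReachesConsensusAt (consensusState H x₀) c := by
  have hall : ∀ i j, Tendsto
      (fun k => consensusState H x₀ k i - consensusState H x₀ k j) atTop (𝓝 0) := by
    intro i j
    have hij := (SimpleGraph.reachable_iff_reflTransGen i j).mp (hG.preconnected i j)
    induction hij with
    | refl => simp
    | tail _ hbc ih => simpa using ih.add (hedge _ _ hbc)
  -- The maximal coordinate decreases and is bounded below; all coordinates share its limit because
  -- their differences vanish.
  let M : ℕ → ℝ := fun k => Finset.univ.sup' Finset.univ_nonempty (consensusState H x₀ k)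
  have hMle : ∀ k i, consensusState H x₀ k i ≤ M k := fun k i =>
    Finset.le_sup' _ (Finset.mem_univ i)
  have hM : Antitone M := antitone_nat_of_succ_le fun k =>
    Finset.sup'_le _ _ fun i _ => consensusState_succ_le h0 h1 (hMle k) i
  have hbdd : BddBelow (Set.range M) := by
    refine ⟨-∑ j, |x₀ j|, ?_⟩
    rintro _ ⟨k, rfl⟩
    refine le_trans ?_ (hMle k 0)
    exact (abs_le.mp (abs_consensusState_le h0 h1 (x₀ := x₀) (fun i =>
      Finset.single_le_sum (f := fun j => |x₀ j|) (fun j _ => abs_nonneg _)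
        (Finset.mem_univ i)) k 0)).1
  refine ⟨⨅ k, M k, fun i => ?_⟩
  have hdiff : Tendsto (fun k => M k - consensusState H x₀ k i) atTop (𝓝 0) := by
    have hsum : Tendsto
        (fun k => ∑ j, |consensusState H x₀ k j - consensusState H x₀ k i|) atTop (𝓝 0) := by
      have := tendsto_finsetSum Finset.univ fun j (_ : j ∈ Finset.univ) => (hall j i).abs
      simpa using this
    refine squeeze_zero (fun k => sub_nonneg.mpr (hMle k i)) (fun k => ?_) hsum
    obtain ⟨j, _, hj⟩ := Finset.exists_mem_eq_sup' Finset.univ_nonempty (consensusState H x₀ k)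
    simp only [M, hj]
    exact (le_abs_self _).trans (Finset.single_le_sum
      (f := fun j => |consensusState H x₀ k j - consensusState H x₀ k i|)
      (fun j _ => abs_nonneg _) (Finset.mem_univ j))
  simpa using (tendsto_atTop_ciInf hM hbdd).sub hdiff

end Consensus

/-! ### Positivity and row sums of the moment matrices. -/

section MomentMatrices

open Kronecker

variable {n : ℕ} {G : SimpleGraph (Fin n)} [DecidableRel G.Adj] {p : Fin n → ℝ}

theorem meanWeight_apply (i j : Fin n) : meanWeight G p i j =
    subsetExpectation (p i) (G.neighborFinset i) (averagingWeight i j) := rfl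

theorem meanWeight_isStochastic (hp : ∀ v, p v ∈ Set.Ioo (0 : ℝ) 1) :
    (meanWeight G p).IsStochastic := by
  constructor
  · intro i j
    rw [meanWeight_apply]
    exact subsetExpectation_nonneg (Set.Ioo_subset_Icc_self (hp i)) (averagingWeight_nonneg i j)
  · intro i
    simp only [meanWeight, Matrix.of_apply]
    rw [← subsetExpectation_sum, ← subsetExpectation_const (p := p i)
      (N := G.neighborFinset i) 1]
    exact subsetExpectation_congr fun s hs =>
      sum_averagingWeight fun hi => G.notMem_neighborFinset_self i (hs hi)

theorem averagingWeight_pos {i j : Fin n} {s : Finset (Fin n)} (hj : j ∈ insert i s) :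
    0 < averagingWeight i j s := by
  rw [averagingWeight, if_pos hj]
  positivity

theorem meanWeight_self_pos (hp : ∀ v, p v ∈ Set.Ioo (0 : ℝ) 1) (i : Fin n) :
    0 < meanWeight G p i i := by
  rw [meanWeight_apply]
  exact subsetExpectation_pos (hp i) (averagingWeight_nonneg i i) (Finset.Subset.refl _)
    (averagingWeight_pos (Finset.mem_insert_self _ _))

theorem meanWeight_pos_of_adj (hp : ∀ v, p v ∈ Set.Ioo (0 : ℝ) 1) {i j : Fin n}
    (hij : G.Adj i j) : 0 < meanWeight G p i j := by
  rw [meanWeight_apply]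
  exact subsetExpectation_pos (hp i) (averagingWeight_nonneg i j) (Finset.Subset.refl _)
    (averagingWeight_pos (Finset.mem_insert_of_mem ((G.mem_neighborFinset i j).mpr hij)))

theorem secondMomentWeight_pos_of_adj (hp : ∀ v, p v ∈ Set.Ioo (0 : ℝ) 1) {i j : Fin n}
    (hij : G.Adj i j) : 0 < secondMomentWeight G p (i, i) (i, j) := by
  rw [secondMomentWeight, Matrix.of_apply, if_pos rfl]
  exact subsetExpectation_pos (hp i)
    (fun s => mul_nonneg (averagingWeight_nonneg i i s) (averagingWeight_nonneg i j s))
    (Finset.Subset.refl _) (mul_pos (averagingWeight_pos (Finset.mem_insert_self _ _))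
      (averagingWeight_pos (Finset.mem_insert_of_mem ((G.mem_neighborFinset i j).mpr hij))))

theorem meanWeight_reflTransGen (hG : G.Connected) (hp : ∀ v, p v ∈ Set.Ioo (0 : ℝ) 1)
    (i j : Fin n) : Relation.ReflTransGen (fun a b => 0 < meanWeight G p a b) i j :=
  ((SimpleGraph.reachable_iff_reflTransGen i j).mp (hG.preconnected i j)).lift id
    fun _ _ hab => meanWeight_pos_of_adj hp hab

theorem secondMomentWeight_nonneg (hp : ∀ v, p v ∈ Set.Ioo (0 : ℝ) 1)
    (ab cd : Fin n × Fin n) : 0 ≤ secondMomentWeight G p ab cd := by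
  rw [secondMomentWeight, Matrix.of_apply]
  split_ifs
  · exact subsetExpectation_nonneg (Set.Ioo_subset_Icc_self (hp _))
      fun s => mul_nonneg (averagingWeight_nonneg _ _ s) (averagingWeight_nonneg _ _ s)
  · exact mul_nonneg ((meanWeight_isStochastic hp).nonneg _ _)
      ((meanWeight_isStochastic hp).nonneg _ _)

theorem sum_secondMomentWeight_snd (hp : ∀ v, p v ∈ Set.Ioo (0 : ℝ) 1)
    (a b c : Fin n) : ∑ d, secondMomentWeight G p (a, b) (c, d) = meanWeight G p a c := by
  simp only [secondMomentWeight, Matrix.of_apply]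
  by_cases hab : a = b
  · subst hab
    simp only [if_true]
    rw [← subsetExpectation_sum, meanWeight_apply]
    refine subsetExpectation_congr fun s hs => ?_
    rw [← Finset.mul_sum, sum_averagingWeight fun hi => G.notMem_neighborFinset_self a (hs hi),
      mul_one]
  · simp only [hab, if_false]
    rw [← Finset.mul_sum, (meanWeight_isStochastic hp).row_sum, mul_one]

theorem secondMomentWeight_swap (a b c d : Fin n) :
    secondMomentWeight G p (a, b) (c, d) = secondMomentWeight G p (b, a) (d, c) := by
  simp only [secondMomentWeight, Matrix.of_apply]
  by_cases hab : a = b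
  · subst hab
    simp only [if_true, mul_comm]
  · simp only [hab, Ne.symm hab, if_false, mul_comm]

/-- Rows `(a, b)` with `a ≠ b` contribute nothing by independence; row `(a, a)` consists of the
covariances of the weights given by `a`. -/
theorem sum_abs_secondMomentWeight_sub_le [NeZero n] (hp : ∀ v, p v ∈ Set.Ioo (0 : ℝ) 1)
    (ab : Fin n × Fin n) :
    ∑ cd, |secondMomentWeight G p ab cd - (meanWeight G p ⊗ₖ meanWeight G p) ab cd| ≤
      Finset.univ.sup' Finset.univ_nonempty fun i => nodeTerm (G.degree i) (p i) := by
  obtain ⟨a, b⟩ := ab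
  have hcov := sum_abs_subsetCovariance_averagingWeight_le (Set.Ioo_subset_Icc_self (hp a))
    (G.notMem_neighborFinset_self a)
  rw [SimpleGraph.card_neighborFinset_eq_degree] at hcov
  refine le_trans ?_ (Finset.le_sup' (fun i => nodeTerm (G.degree i) (p i)) (Finset.mem_univ a))
  refine le_trans ?_ hcov
  refine Finset.sum_le_sum fun cd _ => ?_
  by_cases hab : a = b
  · subst hab
    rw [secondMomentWeight, Matrix.of_apply, if_pos rfl]
    rfl
  · rw [secondMomentWeight, Matrix.of_apply, if_neg hab, Matrix.kroneckerMap_apply, sub_self,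
      abs_zero]
    exact abs_nonneg _

end MomentMatrices

/-! ### Almost sure consensus by a Lyapunov function. -/

section AlmostSureConsensus

variable {n : ℕ} {Ω : Type*} [MeasurableSpace Ω] {μ : Measure Ω} [IsProbabilityMeasure μ]
  {G : SimpleGraph (Fin n)} [DecidableRel G.Adj] {p : Fin n → ℝ}
  {𝒢 : ℕ → Ω → Digraph (Fin n)}

/-- One step of the Lyapunov function `∑ wᵢ 𝔼 xᵢ²` for stationary weights `w`. -/
theorem lyapunov_step (hp : ∀ v, p v ∈ Set.Ioo (0 : ℝ) 1) {w : Fin n → ℝ}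
    (hw : ∀ c, ∑ r, w r * meanWeight G p r c = w c) (R : Fin n → Fin n → ℝ) :
    2 * (∑ i, w i * R i i - ∑ i, w i * ∑ ab : Fin n × Fin n,
      secondMomentWeight G p (i, i) ab * R ab.1 ab.2) =
    ∑ i, w i * ∑ ab : Fin n × Fin n, secondMomentWeight G p (i, i) ab *
      (R ab.1 ab.1 - 2 * R ab.1 ab.2 + R ab.2 ab.2) := by
  -- Summing out one index of the second moment leaves the mean weight, for which `w` is stationary.
  have h1 : ∑ i, w i * ∑ ab : Fin n × Fin n, secondMomentWeight G p (i, i) ab * R ab.1 ab.1 =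
      ∑ i, w i * R i i := by
    have : ∀ i, ∑ ab : Fin n × Fin n, secondMomentWeight G p (i, i) ab * R ab.1 ab.1 =
        ∑ a, meanWeight G p i a * R a a := by
      intro i
      rw [Fintype.sum_prod_type]
      refine Finset.sum_congr rfl fun a _ => ?_
      rw [← sum_secondMomentWeight_snd hp i i a, Finset.sum_mul]
    simp only [this, Finset.mul_sum]
    rw [Finset.sum_comm]
    refine Finset.sum_congr rfl fun a _ => ?_
    rw [← hw a, Finset.sum_mul]
    exact Finset.sum_congr rfl fun i _ => by ring
  have h2 : ∑ i, w i * ∑ ab : Fin n × Fin n, secondMomentWeight G p (i, i) ab * R ab.2 ab.2 =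
      ∑ i, w i * R i i := by
    rw [← h1]
    refine Finset.sum_congr rfl fun i _ => ?_
    congr 1
    rw [Fintype.sum_prod_type, Fintype.sum_prod_type, Finset.sum_comm]
    exact Finset.sum_congr rfl fun a _ => Finset.sum_congr rfl fun b _ => by
      rw [secondMomentWeight_swap]
  have h3 : ∀ i, ∑ ab : Fin n × Fin n, secondMomentWeight G p (i, i) ab *
      (R ab.1 ab.1 - 2 * R ab.1 ab.2 + R ab.2 ab.2) =
      ∑ ab : Fin n × Fin n, secondMomentWeight G p (i, i) ab * R ab.1 ab.1 -
      2 * ∑ ab : Fin n × Fin n, secondMomentWeight G p (i, i) ab * R ab.1 ab.2 +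
      ∑ ab : Fin n × Fin n, secondMomentWeight G p (i, i) ab * R ab.2 ab.2 := by
    intro i
    rw [Finset.mul_sum, ← Finset.sum_sub_distrib, ← Finset.sum_add_distrib]
    exact Finset.sum_congr rfl fun ab _ => by ring
  have h4 : ∑ i, w i * (2 * ∑ ab : Fin n × Fin n,
      secondMomentWeight G p (i, i) ab * R ab.1 ab.2) =
      2 * ∑ i, w i * ∑ ab : Fin n × Fin n, secondMomentWeight G p (i, i) ab * R ab.1 ab.2 := by
    rw [Finset.mul_sum]
    exact Finset.sum_congr rfl fun i _ => by ring
  rw [Finset.sum_congr rfl fun i _ => congrArg (w i * ·) (h3 i)]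
  simp only [mul_add (w _), mul_sub (w _), Finset.sum_add_distrib, Finset.sum_sub_distrib, h1, h2,
    h4]
  ring

namespace IsSwitchingDigraphProcess

omit [DecidableRel G.Adj] in
theorem integrable_consensusState_mul (h : IsSwitchingDigraphProcess G p μ 𝒢)
    (x₀ y₀ : Fin n → ℝ) (k : ℕ) (a b : Fin n) :
    Integrable (fun ω => consensusState (fun j => 𝒢 j ω) x₀ k a *
      consensusState (fun j => 𝒢 j ω) y₀ k b) μ :=
  h.integrable_of_dependsOnEdges ((h.dependsOnEdges_consensusState x₀ k a).mul
    (h.dependsOnEdges_consensusState y₀ k b))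

omit [DecidableRel G.Adj] in
theorem integral_sq_sub (h : IsSwitchingDigraphProcess G p μ 𝒢) (x₀ : Fin n → ℝ) (k : ℕ)
    (a b : Fin n) :
    ∫ ω, (consensusState (fun j => 𝒢 j ω) x₀ k a - consensusState (fun j => 𝒢 j ω) x₀ k b) ^ 2 ∂μ =
    (∫ ω, consensusState (fun j => 𝒢 j ω) x₀ k a * consensusState (fun j => 𝒢 j ω) x₀ k a ∂μ) -
    2 * (∫ ω, consensusState (fun j => 𝒢 j ω) x₀ k a * consensusState (fun j => 𝒢 j ω) x₀ k b ∂μ) +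
    ∫ ω, consensusState (fun j => 𝒢 j ω) x₀ k b * consensusState (fun j => 𝒢 j ω) x₀ k b ∂μ := by
  have hi := h.integrable_consensusState_mul x₀ x₀ k
  have hab : Integrable (fun ω => consensusState (fun j => 𝒢 j ω) x₀ k a *
      consensusState (fun j => 𝒢 j ω) x₀ k a - 2 * (consensusState (fun j => 𝒢 j ω) x₀ k a *
      consensusState (fun j => 𝒢 j ω) x₀ k b)) μ := (hi a a).sub ((hi a b).const_mul 2)
  rw [← integral_const_mul, ← integral_sub (hi a a) ((hi a b).const_mul 2),
    ← integral_add hab (hi b b)]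
  exact integral_congr_ae (ae_of_all _ fun ω => by ring)

/-- The decrement of `V` dominates a positive multiple of the mean squared difference along the
edge, and the decrements telescope to at most `V 0`. -/
theorem summable_integral_sq_sub [NeZero n] (h : IsSwitchingDigraphProcess G p μ 𝒢)
    (hG : G.Connected) (hp : ∀ v, p v ∈ Set.Ioo (0 : ℝ) 1) (x₀ : Fin n → ℝ) {i j : Fin n}
    (hij : G.Adj i j) :
    Summable fun k => ∫ ω, (consensusState (fun j => 𝒢 j ω) x₀ k i -
      consensusState (fun j => 𝒢 j ω) x₀ k j) ^ 2 ∂μ := by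
  have hirr := meanWeight_reflTransGen (p := p) hG hp
  set w := Matrix.stationaryWeight (meanWeight G p) with hw
  have hwpos : ∀ i, 0 < w i := fun i =>
    (meanWeight_isStochastic hp).stationaryWeight_pos fun k => hirr k i
  have hstat := (meanWeight_isStochastic hp).stationaryWeight_vecMul hirr
  let R : ℕ → Fin n → Fin n → ℝ := fun k a b => ∫ ω,
    consensusState (fun j => 𝒢 j ω) x₀ k a * consensusState (fun j => 𝒢 j ω) x₀ k b ∂μ
  let D : ℕ → Fin n → Fin n → ℝ := fun k a b => ∫ ω,
    (consensusState (fun j => 𝒢 j ω) x₀ k a - consensusState (fun j => 𝒢 j ω) x₀ k b) ^ 2 ∂μ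
  let V : ℕ → ℝ := fun k => ∑ i, w i * R k i i
  have hD0 : ∀ k a b, 0 ≤ D k a b := fun k a b => integral_nonneg fun ω => sq_nonneg _
  have hV0 : ∀ k, 0 ≤ V k := fun k => Finset.sum_nonneg fun i _ =>
    mul_nonneg (hwpos i).le (integral_nonneg fun ω => mul_self_nonneg _)
  have hstep : ∀ k, 2 * (V k - V (k + 1)) = ∑ i, w i * ∑ ab : Fin n × Fin n,
      secondMomentWeight G p (i, i) ab * D k ab.1 ab.2 := by
    intro k
    have h1 : V (k + 1) = ∑ i, w i * ∑ ab : Fin n × Fin n,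
        secondMomentWeight G p (i, i) ab * R k ab.1 ab.2 :=
      Finset.sum_congr rfl fun i _ => by
        simp only [R]
        rw [h.integral_consensusState_mul_succ hp]
    rw [h1, lyapunov_step hp hstat (R k)]
    simp only [D, h.integral_sq_sub]
    rfl
  set c := w i * secondMomentWeight G p (i, i) (i, j) with hc
  have hcpos : 0 < c := mul_pos (hwpos i) (secondMomentWeight_pos_of_adj hp hij)
  have hle : ∀ k, c * D k i j ≤ 2 * (V k - V (k + 1)) := by
    intro k
    rw [hstep, hc, mul_assoc]
    have hn : ∀ i' ab, 0 ≤ secondMomentWeight G p (i', i') ab * D k ab.1 ab.2 := fun i' ab =>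
      mul_nonneg (secondMomentWeight_nonneg hp _ _) (hD0 _ _ _)
    refine le_trans ?_ (Finset.single_le_sum (f := fun i => w i * ∑ ab : Fin n × Fin n,
      secondMomentWeight G p (i, i) ab * D k ab.1 ab.2) (fun i' _ => mul_nonneg (hwpos i').le
        (Finset.sum_nonneg fun ab _ => hn i' ab)) (Finset.mem_univ i))
    refine mul_le_mul_of_nonneg_left ?_ (hwpos i).le
    exact Finset.single_le_sum (f := fun ab : Fin n × Fin n =>
      secondMomentWeight G p (i, i) ab * D k ab.1 ab.2) (fun ab _ => hn i ab)
      (Finset.mem_univ (i, j))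
  refine summable_of_sum_range_le (c := 2 * V 0 / c) (fun k => hD0 k i j) fun m => ?_
  rw [le_div_iff₀ hcpos, mul_comm, Finset.mul_sum]
  refine (Finset.sum_le_sum fun k _ => hle k).trans ?_
  rw [← Finset.mul_sum, Finset.sum_range_sub']
  linarith [hV0 m]

theorem ae_tendsto_sub [NeZero n] (h : IsSwitchingDigraphProcess G p μ 𝒢)
    (hG : G.Connected) (hp : ∀ v, p v ∈ Set.Ioo (0 : ℝ) 1) (x₀ : Fin n → ℝ) {i j : Fin n}
    (hij : G.Adj i j) :
    ∀ᵐ ω ∂μ, Tendsto (fun k => consensusState (fun j => 𝒢 j ω) x₀ k i -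
      consensusState (fun j => 𝒢 j ω) x₀ k j) atTop (𝓝 0) := by
  have hsum := h.summable_integral_sq_sub hG hp x₀ hij
  let f : ℕ → Ω → ℝ := fun k ω => (consensusState (fun j => 𝒢 j ω) x₀ k i -
      consensusState (fun j => 𝒢 j ω) x₀ k j) ^ 2
  have hdep : ∀ k, DependsOnEdges 𝒢 (Finset.range k ×ˢ Finset.univ) (f k) := fun k ω ω' hω => by
    simp only [f, h.dependsOnEdges_consensusState x₀ k i ω ω' hω,
      h.dependsOnEdges_consensusState x₀ k j ω ω' hω]
  have hmeas : ∀ k, Measurable (f k) := fun k => h.measurable_of_dependsOnEdges (hdep k)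
  -- By Tonelli the series of squares has finite expectation, so almost surely it converges and its
  -- terms tend to zero.
  have hlint : ∫⁻ ω, ∑' k, ENNReal.ofReal (f k ω) ∂μ ≠ ⊤ := by
    rw [lintegral_tsum fun k => (hmeas k).ennreal_ofReal.aemeasurable]
    have h1 : ∀ k, ∫⁻ ω, ENNReal.ofReal (f k ω) ∂μ = ENNReal.ofReal (∫ ω, f k ω ∂μ) := fun k =>
      (ofReal_integral_eq_lintegral_ofReal (h.integrable_of_dependsOnEdges (hdep k))
        (ae_of_all _ fun ω => sq_nonneg _)).symm
    simp only [h1]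
    exact hsum.tsum_ofReal_ne_top
  filter_upwards [ae_lt_top (Measurable.tsum fun k => (hmeas k).ennreal_ofReal) hlint]
    with ω hω
  have h2 := ENNReal.tendsto_atTop_zero_of_tsum_ne_top hω.ne
  have h3 : Tendsto (fun k => f k ω) atTop (𝓝 0) := by
    have := (ENNReal.tendsto_toReal ENNReal.zero_ne_top).comp h2
    simpa [Function.comp_def, f, ENNReal.toReal_ofReal, sq_nonneg] using this
  have h4 := h3.sqrt
  simp only [f, Real.sqrt_sq_eq_abs, Real.sqrt_zero] at h4
  exact (tendsto_zero_iff_abs_tendsto_zero _).mpr h4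

/-- Almost surely, the trajectory reaches consensus. -/
theorem ae_reachesConsensusAt [NeZero n] (h : IsSwitchingDigraphProcess G p μ 𝒢)
    (hG : G.Connected) (hp : ∀ v, p v ∈ Set.Ioo (0 : ℝ) 1) (x₀ : Fin n → ℝ) :
    ∀ᵐ ω ∂μ, ReachesConsensusAt (consensusState (fun j => 𝒢 j ω) x₀)
      (asymptoticConsensusValue (consensusState (fun j => 𝒢 j ω) x₀)) := by
  have : ∀ᵐ ω ∂μ, ∀ i j, G.Adj i j → Tendsto (fun k => consensusState (fun j => 𝒢 j ω) x₀ k i -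
      consensusState (fun j => 𝒢 j ω) x₀ k j) atTop (𝓝 0) := by
    refine ae_all_iff.mpr fun i => ae_all_iff.mpr fun j => ?_
    by_cases hij : G.Adj i j
    · filter_upwards [h.ae_tendsto_sub hG hp x₀ hij] with ω hω _ using hω
    · exact ae_of_all _ fun ω hij' => absurd hij' hij
  filter_upwards [this] with ω hω
  exact reachesConsensusAt_asymptoticConsensusValue (exists_reachesConsensusAt
    (fun k i j => h.weightMatrix_nonneg k ω i j) (fun k i => h.sum_weightMatrix k ω i) hG x₀ hω)

end IsSwitchingDigraphProcess

end AlmostSureConsensus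

/-! ### Moments of the consensus weights and the variance. -/

section ConsensusWeights

open Kronecker

variable {n : ℕ} {Ω : Type*} [MeasurableSpace Ω] {μ : Measure Ω}
  {G : SimpleGraph (Fin n)} {p : Fin n → ℝ} {𝒢 : ℕ → Ω → Digraph (Fin n)}

/-- The random weight of the initial value of the node `j` in the consensus value. -/
noncomputable def consensusWeight (𝒢 : ℕ → Ω → Digraph (Fin n)) (j : Fin n) (ω : Ω) : ℝ :=
  asymptoticConsensusValue (consensusState (fun k => 𝒢 k ω) (Pi.single j 1))

/-- The second moments of the consensus weights. -/
noncomputable def consensusWeightMoment (μ : Measure Ω) (𝒢 : ℕ → Ω → Digraph (Fin n))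
    (ab : Fin n × Fin n) : ℝ := ∫ ω, consensusWeight 𝒢 ab.1 ω * consensusWeight 𝒢 ab.2 ω ∂μ

/-- The expectation of the consensus weights. -/
noncomputable def meanConsensusWeight (μ : Measure Ω) (𝒢 : ℕ → Ω → Digraph (Fin n))
    (a : Fin n) : ℝ := ∫ ω, consensusWeight 𝒢 a ω ∂μ

theorem consensusState_one {H : ℕ → Digraph (Fin n)}
    (h1 : ∀ k i, ∑ j, weightMatrix (H k) i j = 1) (k : ℕ) (i : Fin n) :
    consensusState H 1 k i = 1 := by
  induction k generalizing i with
  | zero => rfl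
  | succ k ih => simp [consensusState, Matrix.mulVec, dotProduct, ih, h1]

namespace IsSwitchingDigraphProcess

theorem abs_consensusState_single_le (h : IsSwitchingDigraphProcess G p μ 𝒢) (ω : Ω)
    (a : Fin n) (k : ℕ) (i : Fin n) :
    |consensusState (fun j => 𝒢 j ω) (Pi.single a 1) k i| ≤ 1 :=
  abs_consensusState_le (fun k i j => h.weightMatrix_nonneg k ω i j)
    (fun k i => h.sum_weightMatrix k ω i)
    (fun i => by rw [Pi.single_apply]; split_ifs <;> simp) k i

theorem consensusState_single_nonneg (h : IsSwitchingDigraphProcess G p μ 𝒢) (ω : Ω)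
    (a : Fin n) (k : ℕ) (i : Fin n) :
    0 ≤ consensusState (fun j => 𝒢 j ω) (Pi.single a 1) k i := by
  induction k generalizing i with
  | zero =>
    rw [consensusState, Pi.single_apply]
    split_ifs <;> simp
  | succ k ih =>
    exact le_consensusState_succ (fun k i j => h.weightMatrix_nonneg k ω i j)
      (fun k i => h.sum_weightMatrix k ω i) ih i

variable [IsProbabilityMeasure μ] [DecidableRel G.Adj]

theorem integral_consensusState_single_mul (h : IsSwitchingDigraphProcess G p μ 𝒢)
    (hp : ∀ v, p v ∈ Set.Ioo (0 : ℝ) 1) (k : ℕ) (ij ab : Fin n × Fin n) :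
    ∫ ω, consensusState (fun j => 𝒢 j ω) (Pi.single ab.1 1) k ij.1 *
      consensusState (fun j => 𝒢 j ω) (Pi.single ab.2 1) k ij.2 ∂μ =
      (secondMomentWeight G p ^ k) ij ab := by
  induction k generalizing ij with
  | zero =>
    simp only [consensusState, integral_const, probReal_univ, one_smul, pow_zero, Matrix.one_apply,
      Pi.single_apply, Prod.ext_iff]
    split_ifs <;> simp_all
  | succ k ih =>
    rw [h.integral_consensusState_mul_succ hp, pow_succ', Matrix.mul_apply]
    exact Finset.sum_congr rfl fun cd _ => by rw [ih]

variable [NeZero n]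

theorem aestronglyMeasurable_asymptoticConsensusValue (h : IsSwitchingDigraphProcess G p μ 𝒢)
    (hG : G.Connected) (hp : ∀ v, p v ∈ Set.Ioo (0 : ℝ) 1) (x₀ : Fin n → ℝ) :
    AEStronglyMeasurable
      (fun ω => asymptoticConsensusValue (consensusState (fun k => 𝒢 k ω) x₀)) μ := by
  refine aestronglyMeasurable_of_tendsto_ae (u := atTop)
    (f := fun k ω => consensusState (fun j => 𝒢 j ω) x₀ k 0) (fun k =>
    (h.measurable_of_dependsOnEdges
      (h.dependsOnEdges_consensusState x₀ k 0)).aestronglyMeasurable) ?_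
  filter_upwards [h.ae_reachesConsensusAt hG hp x₀] with ω hω using hω 0

theorem ae_tendsto_consensusWeight (h : IsSwitchingDigraphProcess G p μ 𝒢)
    (hG : G.Connected) (hp : ∀ v, p v ∈ Set.Ioo (0 : ℝ) 1) :
    ∀ᵐ ω ∂μ, ∀ a i, Tendsto (fun k => consensusState (fun j => 𝒢 j ω) (Pi.single a 1) k i) atTop
      (𝓝 (consensusWeight 𝒢 a ω)) := by
  refine ae_all_iff.mpr fun a => ?_
  filter_upwards [h.ae_reachesConsensusAt hG hp (Pi.single a 1)] with ω hω i using hω i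

theorem ae_consensusWeight_mem_Icc (h : IsSwitchingDigraphProcess G p μ 𝒢)
    (hG : G.Connected) (hp : ∀ v, p v ∈ Set.Ioo (0 : ℝ) 1) :
    ∀ᵐ ω ∂μ, ∀ a, consensusWeight 𝒢 a ω ∈ Set.Icc (0 : ℝ) 1 := by
  filter_upwards [h.ae_tendsto_consensusWeight hG hp] with ω hω a
  exact isClosed_Icc.mem_of_tendsto (hω a 0) (Eventually.of_forall fun k =>
    ⟨h.consensusState_single_nonneg ω a k 0,
      (le_abs_self _).trans (h.abs_consensusState_single_le ω a k 0)⟩)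

theorem ae_asymptoticConsensusValue_eq (h : IsSwitchingDigraphProcess G p μ 𝒢)
    (hG : G.Connected) (hp : ∀ v, p v ∈ Set.Ioo (0 : ℝ) 1) (x₀ : Fin n → ℝ) :
    (fun ω => asymptoticConsensusValue (consensusState (fun k => 𝒢 k ω) x₀)) =ᵐ[μ]
      fun ω => ∑ j, x₀ j * consensusWeight 𝒢 j ω := by
  filter_upwards [h.ae_tendsto_consensusWeight hG hp, h.ae_reachesConsensusAt hG hp x₀]
    with ω hω hx
  refine tendsto_nhds_unique (hx 0) ?_
  have := tendsto_finsetSum Finset.univ fun j (_ : j ∈ Finset.univ) => (hω j 0).const_mul (x₀ j)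
  exact this.congr fun k => (consensusState_smul_add x₀ k 0).symm

theorem ae_sum_consensusWeight (h : IsSwitchingDigraphProcess G p μ 𝒢)
    (hG : G.Connected) (hp : ∀ v, p v ∈ Set.Ioo (0 : ℝ) 1) :
    ∀ᵐ ω ∂μ, ∑ j, consensusWeight 𝒢 j ω = 1 := by
  filter_upwards [h.ae_asymptoticConsensusValue_eq hG hp 1, h.ae_reachesConsensusAt hG hp 1]
    with ω hω hx
  simp only [Pi.one_apply, one_mul] at hω
  rw [← hω]
  refine tendsto_nhds_unique (hx 0) ?_
  simp only [consensusState_one fun k i => h.sum_weightMatrix k ω i]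
  exact tendsto_const_nhds

theorem integrable_consensusWeight (h : IsSwitchingDigraphProcess G p μ 𝒢)
    (hG : G.Connected) (hp : ∀ v, p v ∈ Set.Ioo (0 : ℝ) 1) (a : Fin n) :
    Integrable (consensusWeight 𝒢 a) μ := by
  refine Integrable.of_bound (h.aestronglyMeasurable_asymptoticConsensusValue hG hp _) 1 ?_
  filter_upwards [h.ae_consensusWeight_mem_Icc hG hp] with ω hω
  exact (abs_of_nonneg (hω a).1).trans_le (hω a).2

theorem integrable_consensusWeight_mul (h : IsSwitchingDigraphProcess G p μ 𝒢)
    (hG : G.Connected) (hp : ∀ v, p v ∈ Set.Ioo (0 : ℝ) 1) (a b : Fin n) :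
    Integrable (fun ω => consensusWeight 𝒢 a ω * consensusWeight 𝒢 b ω) μ := by
  refine Integrable.of_bound ((h.aestronglyMeasurable_asymptoticConsensusValue hG hp _).mul
    (h.aestronglyMeasurable_asymptoticConsensusValue hG hp _)) 1 ?_
  filter_upwards [h.ae_consensusWeight_mem_Icc hG hp] with ω hω
  rw [Real.norm_of_nonneg (mul_nonneg (hω a).1 (hω b).1)]
  exact mul_le_one₀ (hω a).2 (hω b).1 (hω b).2

/-- The powers of the second moment matrix converge to a matrix of rank one. -/
theorem tendsto_secondMomentWeight_pow (h : IsSwitchingDigraphProcess G p μ 𝒢)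
    (hG : G.Connected) (hp : ∀ v, p v ∈ Set.Ioo (0 : ℝ) 1) (ij ab : Fin n × Fin n) :
    Tendsto (fun k => (secondMomentWeight G p ^ k) ij ab) atTop
      (𝓝 (consensusWeightMoment μ 𝒢 ab)) := by
  simp only [← h.integral_consensusState_single_mul hp]
  refine tendsto_integral_of_dominated_convergence (fun _ => 1)
    (fun k => (h.integrable_consensusState_mul _ _ k _ _).aestronglyMeasurable)
    (integrable_const 1) (fun k => ae_of_all _ fun ω => ?_) ?_
  · rw [norm_mul]
    exact mul_le_one₀ (h.abs_consensusState_single_le ω _ k _) (norm_nonneg _)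
      (h.abs_consensusState_single_le ω _ k _)
  · filter_upwards [h.ae_tendsto_consensusWeight hG hp] with ω hω
    exact (hω ab.1 ij.1).mul (hω ab.2 ij.2)

/-- The moments are the limit of a row of the powers; pass to the limit in `S ^ (k + 1) = S ^ k *
S`. -/
theorem consensusWeightMoment_stationary (h : IsSwitchingDigraphProcess G p μ 𝒢)
    (hG : G.Connected) (hp : ∀ v, p v ∈ Set.Ioo (0 : ℝ) 1) (cd : Fin n × Fin n) :
    ∑ ab, consensusWeightMoment μ 𝒢 ab * secondMomentWeight G p ab cd =
      consensusWeightMoment μ 𝒢 cd := by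
  have h1 := (h.tendsto_secondMomentWeight_pow hG hp (0, 0) cd).comp (tendsto_add_atTop_nat 1)
  refine tendsto_nhds_unique ?_ h1
  simp only [Function.comp_def, pow_succ, Matrix.mul_apply]
  exact tendsto_finsetSum Finset.univ fun ab _ =>
    (h.tendsto_secondMomentWeight_pow hG hp (0, 0) ab).mul_const _

theorem sum_consensusWeightMoment_snd (h : IsSwitchingDigraphProcess G p μ 𝒢)
    (hG : G.Connected) (hp : ∀ v, p v ∈ Set.Ioo (0 : ℝ) 1) (a : Fin n) :
    ∑ b, consensusWeightMoment μ 𝒢 (a, b) = meanConsensusWeight μ 𝒢 a := by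
  simp only [consensusWeightMoment]
  rw [← integral_finsetSum _ fun b _ => h.integrable_consensusWeight_mul hG hp a b]
  refine integral_congr_ae ?_
  filter_upwards [h.ae_sum_consensusWeight hG hp] with ω hω
  rw [← Finset.mul_sum, hω, mul_one]

theorem sum_meanConsensusWeight (h : IsSwitchingDigraphProcess G p μ 𝒢)
    (hG : G.Connected) (hp : ∀ v, p v ∈ Set.Ioo (0 : ℝ) 1) :
    ∑ a, meanConsensusWeight μ 𝒢 a = 1 := by
  simp only [meanConsensusWeight]
  rw [← integral_finsetSum _ fun a _ => h.integrable_consensusWeight hG hp a,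
    integral_congr_ae (h.ae_sum_consensusWeight hG hp)]
  simp

/-- The stationarity of the second moments is summed over one index, where the weights add up to
one. -/
theorem meanConsensusWeight_stationary (h : IsSwitchingDigraphProcess G p μ 𝒢)
    (hG : G.Connected) (hp : ∀ v, p v ∈ Set.Ioo (0 : ℝ) 1) (c : Fin n) :
    ∑ a, meanConsensusWeight μ 𝒢 a * meanWeight G p a c = meanConsensusWeight μ 𝒢 c := by
  rw [← h.sum_consensusWeightMoment_snd hG hp c]
  simp only [← h.consensusWeightMoment_stationary hG hp (c, _)]
  rw [Finset.sum_comm, Fintype.sum_prod_type]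
  refine Finset.sum_congr rfl fun a _ => ?_
  rw [← h.sum_consensusWeightMoment_snd hG hp a, Finset.sum_mul]
  refine Finset.sum_congr rfl fun b _ => ?_
  rw [← Finset.mul_sum, sum_secondMomentWeight_snd hp]

theorem consensusWeightMoment_nonneg (h : IsSwitchingDigraphProcess G p μ 𝒢)
    (hG : G.Connected) (hp : ∀ v, p v ∈ Set.Ioo (0 : ℝ) 1) (ab : Fin n × Fin n) :
    0 ≤ consensusWeightMoment μ 𝒢 ab := by
  refine integral_nonneg_of_ae ?_
  filter_upwards [h.ae_consensusWeight_mem_Icc hG hp] with ω hω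
  exact mul_nonneg (hω _).1 (hω _).1

/-- The covariances of the consensus weights are bounded through the sensitivity of the stationary
distribution of the Kronecker square of the expected weight matrix. -/
theorem abs_covariance_consensusWeight_mul_le (h : IsSwitchingDigraphProcess G p μ 𝒢)
    (hG : G.Connected) (hp : ∀ v, p v ∈ Set.Ioo (0 : ℝ) 1) (ab : Fin n × Fin n) :
    |consensusWeightMoment μ 𝒢 ab -
        meanConsensusWeight μ 𝒢 ab.1 * meanConsensusWeight μ 𝒢 ab.2| *
      ∑ ij, Matrix.stationaryWeight (meanWeight G p ⊗ₖ meanWeight G p) ij ≤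
    ((n : ℝ) ^ 2 - 1) *
      Finset.univ.sup' Finset.univ_nonempty fun i => nodeTerm (G.degree i) (p i) := by
  set S := secondMomentWeight G p with hS
  set K := meanWeight G p ⊗ₖ meanWeight G p with hK
  set m := consensusWeightMoment μ 𝒢 with hm
  set π := meanConsensusWeight μ 𝒢 with hπ
  set s := Finset.univ.sup' Finset.univ_nonempty fun i => nodeTerm (G.degree i) (p i) with hs
  have hm1 : ∑ ab, m ab = 1 := by
    rw [Fintype.sum_prod_type]
    simp only [hm, h.sum_consensusWeightMoment_snd hG hp]
    exact h.sum_meanConsensusWeight hG hp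
  have hπ1 : ∑ a, π a = 1 := h.sum_meanConsensusWeight hG hp
  have hstat : ∀ c, ∑ a, π a * meanWeight G p a c = π c :=
    h.meanConsensusWeight_stationary hG hp
  have hππ : ∀ cd : Fin n × Fin n, ∑ ab : Fin n × Fin n, π ab.1 * π ab.2 * K ab cd =
      π cd.1 * π cd.2 := by
    intro cd
    rw [← hstat cd.1, ← hstat cd.2, Finset.sum_mul_sum, Fintype.sum_prod_type]
    exact Finset.sum_congr rfl fun a _ => Finset.sum_congr rfl fun b _ => by
      rw [hK, Matrix.kroneckerMap_apply]
      ring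
  -- As `m` is stationary for `S` and `π ⊗ π` for `K`, this is the image of `m - π ⊗ π` under `1 -
  -- K`.
  let q : Fin n × Fin n → ℝ := fun cd => ∑ ab, m ab * (S ab cd - K ab cd)
  have hq : ∑ cd, |q cd| ≤ s := by
    calc ∑ cd, |q cd| ≤ ∑ cd, ∑ ab, m ab * |S ab cd - K ab cd| := by
          refine Finset.sum_le_sum fun cd _ => (Finset.abs_sum_le_sum_abs _ _).trans_eq ?_
          exact Finset.sum_congr rfl fun ab _ => by
            rw [abs_mul, abs_of_nonneg (h.consensusWeightMoment_nonneg hG hp ab)]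
      _ = ∑ ab, m ab * ∑ cd, |S ab cd - K ab cd| := by
          rw [Finset.sum_comm]
          simp only [Finset.mul_sum]
      _ ≤ ∑ ab, m ab * s := Finset.sum_le_sum fun ab _ => mul_le_mul_of_nonneg_left
          (sum_abs_secondMomentWeight_sub_le hp ab) (h.consensusWeightMoment_nonneg hG hp ab)
      _ = s := by rw [← Finset.sum_mul, hm1, one_mul]
  have hKs : K.IsStochastic := (meanWeight_isStochastic hp).kronecker_self
  have key := hKs.abs_apply_mul_sum_stationaryWeight_le
    (Matrix.reflTransGen_kronecker_self (meanWeight_self_pos hp) (meanWeight_reflTransGen hG hp))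
    (y := fun ab => m ab - π ab.1 * π ab.2) (q := q) ?_ ?_ ab
  · refine key.trans ?_
    rw [Fintype.card_prod, Fintype.card_fin, Nat.cast_mul, ← sq]
    refine mul_le_mul_of_nonneg_left hq (sub_nonneg.mpr ?_)
    exact one_le_pow₀ (by exact_mod_cast NeZero.one_le)
  · rw [Finset.sum_sub_distrib, hm1, Fintype.sum_prod_type]
    simp only [← Finset.mul_sum, hπ1, mul_one, sub_self]
  · intro cd
    simp only [sub_mul, Finset.sum_sub_distrib, q, mul_sub]
    rw [hππ cd, h.consensusWeightMoment_stationary hG hp cd]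
    ring

theorem memLp_asymptoticConsensusValue (h : IsSwitchingDigraphProcess G p μ 𝒢)
    (hG : G.Connected) (hp : ∀ v, p v ∈ Set.Ioo (0 : ℝ) 1) (x₀ : Fin n → ℝ) :
    MemLp (fun ω => asymptoticConsensusValue (consensusState (fun k => 𝒢 k ω) x₀)) 2 μ := by
  refine MemLp.of_bound (h.aestronglyMeasurable_asymptoticConsensusValue hG hp x₀)
    (∑ j, |x₀ j|) ?_
  filter_upwards [h.ae_asymptoticConsensusValue_eq hG hp x₀, h.ae_consensusWeight_mem_Icc hG hp]
    with ω hω hv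
  rw [hω]
  refine (Finset.abs_sum_le_sum_abs _ _).trans (Finset.sum_le_sum fun j _ => ?_)
  rw [abs_mul, abs_of_nonneg (hv j).1]
  exact mul_le_of_le_one_right (abs_nonneg _) (hv j).2

theorem variance_asymptoticConsensusValue (h : IsSwitchingDigraphProcess G p μ 𝒢)
    (hG : G.Connected) (hp : ∀ v, p v ∈ Set.Ioo (0 : ℝ) 1) (x₀ : Fin n → ℝ) :
    variance (fun ω => asymptoticConsensusValue (consensusState (fun k => 𝒢 k ω) x₀)) μ =
      ∑ ab : Fin n × Fin n, vecKronecker x₀ x₀ ab * (consensusWeightMoment μ 𝒢 ab -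
        meanConsensusWeight μ 𝒢 ab.1 * meanConsensusWeight μ 𝒢 ab.2) := by
  have hae := h.ae_asymptoticConsensusValue_eq hG hp x₀
  rw [variance_congr hae,
    variance_eq_sub ((memLp_congr_ae hae).mp (h.memLp_asymptoticConsensusValue hG hp x₀))]
  have h1 : μ[fun ω => ∑ j, x₀ j * consensusWeight 𝒢 j ω] =
      ∑ j, x₀ j * meanConsensusWeight μ 𝒢 j := by
    rw [integral_finsetSum _ fun j _ => (h.integrable_consensusWeight hG hp j).const_mul _]
    exact Finset.sum_congr rfl fun j _ => integral_const_mul _ _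
  have h2 : μ[(fun ω => ∑ j, x₀ j * consensusWeight 𝒢 j ω) ^ 2] =
      ∑ ab : Fin n × Fin n, vecKronecker x₀ x₀ ab * consensusWeightMoment μ 𝒢 ab := by
    have : ((fun ω => ∑ j, x₀ j * consensusWeight 𝒢 j ω) ^ 2) = fun ω =>
        ∑ ab : Fin n × Fin n, vecKronecker x₀ x₀ ab *
          (consensusWeight 𝒢 ab.1 ω * consensusWeight 𝒢 ab.2 ω) := by
      ext ω
      rw [Pi.pow_apply, sq, Finset.sum_mul_sum, Fintype.sum_prod_type]
      exact Finset.sum_congr rfl fun a _ => Finset.sum_congr rfl fun b _ => by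
        simp only [vecKronecker]; ring
    rw [this, integral_finsetSum _ fun ab _ =>
      (h.integrable_consensusWeight_mul hG hp ab.1 ab.2).const_mul _]
    exact Finset.sum_congr rfl fun j _ => integral_const_mul _ _
  rw [h1, h2, sq, Finset.sum_mul_sum]
  simp only [mul_sub, Finset.sum_sub_distrib]
  congr 1
  rw [Fintype.sum_prod_type]
  exact Finset.sum_congr rfl fun a _ => Finset.sum_congr rfl fun b _ => by
    simp only [vecKronecker]; ring

end IsSwitchingDigraphProcess

end ConsensusWeights

/-! ### The eigenvalue listing. -/

section Eigenvalues

variable {n : ℕ} {P : Matrix (Fin n) (Fin n) ℝ} {lam : Fin n → ℂ}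

open Polynomial in
theorem IsEigenvalueListing.charpoly_eq (h : IsEigenvalueListing P lam) :
    (P.map (algebraMap ℝ ℂ)).charpoly = ∏ i, (X - C (lam i)) := by
  have h1 := (IsAlgClosed.splits (P.map (algebraMap ℝ ℂ)).charpoly).eq_prod_roots_of_monic
    (Matrix.charpoly_monic _)
  rw [h1, h.1, Multiset.map_map]
  rfl

/-- A stochastic matrix has the eigenvalue one, and the ordering by distance to one puts it first.
-/
theorem IsEigenvalueListing.apply_zero_eq_one [NeZero n] (h : IsEigenvalueListing P lam)
    (hP : P.IsStochastic) : lam 0 = 1 := by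
  have h1 : ((P.map (algebraMap ℝ ℂ)).charpoly).eval 1 = 0 := by
    have h2 : (P.map (algebraMap ℝ ℂ)).charpoly.eval 1 = algebraMap ℝ ℂ (P.charpoly.eval 1) := by
      rw [Matrix.charpoly_map, ← map_one (algebraMap ℝ ℂ), Polynomial.eval_map_algebraMap,
        Polynomial.aeval_algebraMap_apply]
      simp
    rw [h2, Matrix.eval_charpoly, map_one, hP.det_one_sub, map_zero]
  rw [h.charpoly_eq, Polynomial.eval_prod, Finset.prod_eq_zero_iff] at h1
  obtain ⟨i, _, hi⟩ := h1
  have h3 := h.2 (Fin.zero_le i)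
  simp only [Polynomial.eval_sub, Polynomial.eval_X, Polynomial.eval_C] at hi
  simp only [hi, norm_zero] at h3
  exact (sub_eq_zero.mp (norm_le_zero_iff.mp h3)).symm

end Eigenvalues

/-! ### The variance bound. -/

theorem theorem2 {n : ℕ} [NeZero n] {Ω : Type*} [MeasurableSpace Ω]
    (μ : Measure Ω) [IsProbabilityMeasure μ]
    (G : SimpleGraph (Fin n)) [DecidableRel G.Adj] (hG : G.Connected)
    (p : Fin n → ℝ) (hp : ∀ v, p v ∈ Set.Ioo (0 : ℝ) 1)
    (𝒢 : ℕ → Ω → Digraph (Fin n)) (h𝒢 : IsSwitchingDigraphProcess G p μ 𝒢)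
    (x₀ : Fin n → ℝ) (k : ℕ) (lam : Fin n → ℂ)
    (hlam : IsEigenvalueListing (expectedWeightMatrix μ (𝒢 k)) lam) :
    let x : Ω → ℕ → Fin n → ℝ := fun ω => consensusState (fun j => 𝒢 j ω) x₀
    let xstar : Ω → ℝ := fun ω => asymptoticConsensusValue (x ω)
    let prodTerm : ℂ := ∏ ij ∈ (Finset.univ : Finset (Fin n × Fin n)).erase (0, 0),
      (1 - lam ij.1 * lam ij.2)
    (∀ᵐ ω ∂μ, ReachesConsensusAt (x ω) (xstar ω)) ∧
    MemLp xstar 2 μ ∧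
    prodTerm.im = 0 ∧ 0 < prodTerm.re ∧
    variance xstar μ ≤
      (∑ ij, |vecKronecker x₀ x₀ ij|) *
      (Finset.univ.sup' Finset.univ_nonempty fun i => nodeTerm (G.degree i) (p i)) *
      (2 * ((n : ℝ) ^ 2 - 1) / prodTerm.re) := by
  intro x xstar prodTerm
  rw [h𝒢.expectedWeightMatrix_eq hp] at hlam
  have hP := meanWeight_isStochastic (G := G) hp
  have hirr := Matrix.reflTransGen_kronecker_self (meanWeight_self_pos hp)
    (meanWeight_reflTransGen hG hp)
  -- The product is a sum of positive real minors, so it is real and positive.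
  have hprod : _ = prodTerm := Matrix.sum_stationaryWeight_kronecker_self hP.kronecker_self hirr
    hlam.charpoly_eq (hlam.apply_zero_eq_one hP)
  have hpos : 0 < ∑ ij, Matrix.stationaryWeight
      (Matrix.kroneckerMap (· * ·) (meanWeight G p) (meanWeight G p)) ij :=
    Finset.sum_pos (fun ij _ => hP.kronecker_self.stationaryWeight_pos fun kl => hirr kl ij)
      Finset.univ_nonempty
  refine ⟨h𝒢.ae_reachesConsensusAt hG hp x₀, h𝒢.memLp_asymptoticConsensusValue hG hp x₀, ?_, ?_,
    ?_⟩
  · rw [← hprod, Complex.ofReal_im]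
  · rw [← hprod, Complex.ofReal_re]
    exact hpos
  · rw [h𝒢.variance_asymptoticConsensusValue hG hp x₀, ← hprod, Complex.ofReal_re]
    set s := Finset.univ.sup' Finset.univ_nonempty fun i => nodeTerm (G.degree i) (p i) with hs
    set D := ∑ ij, Matrix.stationaryWeight
      (Matrix.kroneckerMap (· * ·) (meanWeight G p) (meanWeight G p)) ij with hD
    have hs0 : 0 ≤ s := (Finset.sum_nonneg fun cd _ => abs_nonneg _).trans
      (sum_abs_secondMomentWeight_sub_le hp (0, 0))
    have hn : (0 : ℝ) ≤ (n : ℝ) ^ 2 - 1 :=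
      sub_nonneg.mpr (one_le_pow₀ (by exact_mod_cast NeZero.one_le))
    rw [mul_assoc, Finset.sum_mul]
    refine Finset.sum_le_sum fun ab _ => (le_abs_self _).trans ?_
    rw [abs_mul]
    refine mul_le_mul_of_nonneg_left ?_ (abs_nonneg _)
    rw [← mul_div_assoc, le_div_iff₀ hpos]
    refine (h𝒢.abs_covariance_consensusWeight_mul_le hG hp ab).trans ?_
    -- The covariance bound holds without the factor `2`, which is slack here.
    nlinarith [mul_nonneg hn hs0]
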